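/- Let $l\in\mathbb N$, let $0\ne A\in\mathbb C^{l\times l}$ be Hermitian, $b\in\mathbb R^l$, $c\in\mathbb R$, and consider the polynomial in the non-commuting self-adjoint variables $X=(X_1,\dots,X_l)$ $$q(X)=\sum_{i,j=1}^l X_iA_{ij}X_j+\sum_{i=1}^l b_iX_i+c .$$ Call $q$ shifted reducible if $q(X)=\alpha\,(v^*X-\xi)(v^*X-\xi)^*-\beta$ for some $\alpha,\beta,\xi\in\mathbb R$ with $\alpha\neq0$, $\xi\ge0$ and some $v\in\mathbb C^l$ with $\|v\|=1$, where $v^*X=\sum_i\overline{v_i}X_i$ and $(v^*X)^*=\sum_i v_iX_i$; otherwise call $q$ non-reducible. Let $\rho$ be the self-consistent density of states of $q$, that is, the probability measure on $\mathbb R$ whose Stieltjes transform $m(z)=\int_{\mathbb R}\frac{\rho(\mathrm dx)}{x-z}$ is the unique analytic function $m:\mathbb H\to\mathbb H$ on the upper half-plane $\mathbb H$ with $\lim_{z\to\infty}z\,m(z)=-1$ and, for all $z\in\mathbb H$, $$-\frac1{m(z)}=z+\gamma(m(z)),\qquad \gamma(m)=-\operatorname{Tr}A(I+mA)^{-1}+m\,b^t\big((I+2m\widehat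 A)^{-2}(I+m\widehat A)\big)b-c,\qquad \widehat A=\tfrac12(A+A^t).$$ (This $\rho$ is the limiting spectral measure of $q$ evaluated at $l$ independent Wigner matrices.) If $q$ is non-reducible, then $\operatorname{supp}\rho$ has a smallest element $\tau_-$ and a largest element $\tau_+$, and $\rho$ has a regular edge at both of them. That is, for each $\tau_0\in\{\tau_-,\tau_+\}$ the measure $\rho$ has a Lebesgue density, also denoted by $\rho$, in a neighbourhood of $\tau_0$, and the limit $$\lim_{E\to\tau_0,\;E\in\operatorname{supp}\rho,\;E\ne\tau_0}\frac{\rho(E)}{\sqrt{|\tau_0-E|}}$$ exists, is finite and is not $0$. -/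

import Mathlib

open MeasureTheory Filter Topology

noncomputable section

namespace QuadPoly

/-- The entrywise real part `Â = (A + Aᵗ) / 2` of a Hermitian matrix `A`. -/
def hat {l : ℕ} (A : Matrix (Fin l) (Fin l) ℂ) : Matrix (Fin l) (Fin l) ℂ :=
  (1 / 2 : ℂ) • (A + A.transpose)

/-- The polynomial `∑ i j, X i * A i j * X j + ∑ i, b i * X i + c` in the non-commuting
variables `X i`. -/
def poly {l : ℕ} (A : Matrix (Fin l) (Fin l) ℂ) (b : Fin l → ℝ) (c : ℝ) :
    FreeAlgebra ℂ (Fin l) :=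
  ∑ i, ∑ j, A i j • (FreeAlgebra.ι ℂ i * FreeAlgebra.ι ℂ j)
    + ∑ i, (b i : ℂ) • FreeAlgebra.ι ℂ i
    + algebraMap ℂ (FreeAlgebra ℂ (Fin l)) (c : ℂ)

/-- A polynomial is shifted reducible if it is `α (v^* X - ξ) (v^* X - ξ)^* - β` with real `α ≠ 0`,
`β`, `ξ ≥ 0` and a unit vector `v`. The variables `X i` are self-adjoint, so that
`v^* X = ∑ i, conj (v i) * X i` has the adjoint `∑ i, v i * X i`. -/
def IsShiftedReducible {l : ℕ} (q : FreeAlgebra ℂ (Fin l)) : Prop :=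
  ∃ (α β ξ : ℝ) (v : EuclideanSpace ℂ (Fin l)), α ≠ 0 ∧ 0 ≤ ξ ∧ ‖v‖ = 1 ∧
    q = (α : ℂ) •
          ((∑ i, (starRingEnd ℂ) (v i) • FreeAlgebra.ι ℂ i
              - algebraMap ℂ (FreeAlgebra ℂ (Fin l)) (ξ : ℂ)) *
            (∑ i, v i • FreeAlgebra.ι ℂ i
              - algebraMap ℂ (FreeAlgebra ℂ (Fin l)) (ξ : ℂ)))
        - algebraMap ℂ (FreeAlgebra ℂ (Fin l)) (β : ℂ)

/-- `γ(m) = - Tr A (1 + m A)⁻¹ + m bᵗ ((1 + 2 m Â)⁻² (1 + m Â)) b - c`. For `A` Hermitian and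
`m` in the upper half-plane both inverses are those of invertible matrices. -/
def gamma {l : ℕ} (A : Matrix (Fin l) (Fin l) ℂ) (b : Fin l → ℝ) (c : ℝ) (m : ℂ) : ℂ :=
  - (A * (1 + m • A)⁻¹).trace
    + m * ((fun i => (b i : ℂ)) ⬝ᵥ
        Matrix.mulVec (((1 + (2 * m) • hat A)⁻¹) ^ 2 * (1 + m • hat A)) (fun i => (b i : ℂ)))
    - (c : ℂ)

/-- The open upper half-plane. -/
def upper : Set ℂ := {z : ℂ | 0 < z.im}

/-- `m` is an analytic map from the upper half-plane to itself with `z m(z) → -1` as `z → ∞` and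
`-1 / m(z) = z + γ(m(z))`. -/
structure SolvesScalarEquation {l : ℕ} (A : Matrix (Fin l) (Fin l) ℂ) (b : Fin l → ℝ) (c : ℝ)
    (m : ℂ → ℂ) : Prop where
  mapsTo : Set.MapsTo m upper upper
  analytic : DifferentiableOn ℂ m upper
  tendsto : Tendsto (fun z => z * m z) (Bornology.cobounded ℂ ⊓ 𝓟 upper) (𝓝 (-1))
  equation : ∀ z ∈ upper, -(m z)⁻¹ = z + gamma A b c (m z)

/-- The Stieltjes transform `z ↦ ∫ ρ(dx) / (x - z)`. -/
def stieltjes (ρ : Measure ℝ) (z : ℂ) : ℂ := ∫ x : ℝ, ((x : ℂ) - z)⁻¹ ∂ρ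

/-- `ρ` is the self-consistent density of states (limiting spectral measure) of the polynomial
with coefficients `A`, `b`, `c`: the probability measure whose Stieltjes transform is the solution
of the scalar equation. -/
def IsSelfConsistentDensityOfStates {l : ℕ} (A : Matrix (Fin l) (Fin l) ℂ) (b : Fin l → ℝ) (c : ℝ)
    (ρ : Measure ℝ) : Prop :=
  IsProbabilityMeasure ρ ∧ SolvesScalarEquation A b c (stieltjes ρ)

/-- `ρ` has a regular edge at `τ`: near `τ` it has a Lebesgue density `f`, and
`f E / √|τ - E|` has a non-zero limit as `E → τ` in the support of `ρ`. -/
def HasRegularEdge (ρ : Measure ℝ) (τ : ℝ) : Prop :=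
  ∃ (ε : ℝ) (f : ℝ → ℝ), 0 < ε ∧ Measurable f ∧ (∀ x, 0 ≤ f x) ∧
    ρ.restrict (Set.Ioo (τ - ε) (τ + ε)) =
      (volume.restrict (Set.Ioo (τ - ε) (τ + ε))).withDensity (fun x => ENNReal.ofReal (f x)) ∧
    ∃ L : ℝ, L ≠ 0 ∧
      Tendsto (fun E => f E / Real.sqrt |τ - E|) (𝓝[ρ.support \ {τ}] τ) (𝓝 L)

end QuadPoly

end

/-!
In an eigenbasis of `A` and one of `Â` the scalar equation says that the Stieltjes transform `m` of
`ρ` is a right inverse of the rational function `Z(w) = -1 / w - γ(w)`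
(`SpectralData.invMap`, `invMap_spectralData`). Left of the support, `m` is real, positive and
increasing, so that there it is an increasing branch of the inverse of `Z`, starting at `0` for
`x = -∞`.

With `1 - F(w) = w² Z'(w)`, a non-reducible polynomial satisfies `F > 1` somewhere between `0` and
the first positive pole of `Z` (`NonReducible.exists_slope_neg`): either there is a positive pole,
at which `F` is infinite, or `A` is positive semidefinite, and then `F` has a limit larger than `1`
at infinity if `A` has rank at least two or if `b` is not in the range of `Â`. In the remaining
case `A = α v v^*` has rank one and `b = Â x` is a multiple of the real part of `ζ v` for a complex
number `ζ`, which makes the polynomial shifted reducible (`isShiftedReducible_of_rank_one`). As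
`Z' ≥ 0` on the range of `m`, the transform `m` has a finite limit `M` before the first pole as `x`
increases to the bottom `τ` of the support (`exists_limit`). If `Z'(M)` were positive, `m` would
continue analytically, with real values, to a neighbourhood of `τ`, and `τ` would not be in the
support (`notMem_support`). Hence `Z'(M) = 0`.

The decisive point is that this critical point is not degenerate, although `F` need not be monotone
(`NonReducible.secondQuotient_neg`). With `a` the largest eigenvalue of `M A`, which bounds those of
`M Â`, the identity `F(M) = 1` gives a lower bound for `M F'(M) / 2`: if `a > 1`, it is at least
`a² / (1 + a)³ + (1 - a) / (1 + 2 a) * (1 - a² / (1 + a)²) = 1 / (1 + a)³`, while for `a ≤ 1` all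
summands are nonnegative. Therefore `τ - Z` has an analytic square root with a simple zero at `M`,
`m` is an analytic function of `√(τ - z)` near `τ` (`exists_sqrt_expansion`), and Stieltjes
inversion (`restrict_Ioo_eq_withDensity`) yields a density that behaves like a square root
(`hasRegularEdge_of_sqrt_expansion`). The top of the support is treated by reflecting the measure,
which corresponds to the polynomial with the opposite sign (`SpectralData.IsSolution.reflect`).
-/

open MeasureTheory Filter Topology

noncomputable section

namespace QuadPoly

/-! ### The scalar equation in spectral coordinates -/

/-- The spectral form of the coefficients of a quadratic polynomial: the eigenvalues `eig` of `A`,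
the eigenvalues `hatEig` of `Â`, the squared absolute values `weight` of the coordinates of `b` in
an eigenbasis of `Â`, and the constant term `shift`. -/
structure SpectralData (ι κ : Type*) where
  eig : ι → ℝ
  weight : κ → ℝ
  hatEig : κ → ℝ
  shift : ℝ

namespace SpectralData

variable {ι κ : Type*} [Fintype ι] [Fintype κ] (d : SpectralData ι κ)

/-- The rational function `w ↦ -1 / w - γ(w)` of which `z ↦ m(z)` is a right inverse. -/
def invMap (w : ℂ) : ℂ :=
  -w⁻¹ + ∑ i, (d.eig i : ℂ) / (1 + w * d.eig i)
    - w * ∑ j, (d.weight j : ℂ) * (1 + w * d.hatEig j) / (1 + 2 * w * d.hatEig j) ^ 2 + d.shift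

/-- The derivative of `invMap` at a real point. -/
def slope (M : ℝ) : ℝ :=
  1 / M ^ 2 - ∑ i, d.eig i ^ 2 / (1 + M * d.eig i) ^ 2
    - ∑ j, d.weight j / (1 + 2 * M * d.hatEig j) ^ 3

/-- The second order difference quotient of `invMap` at the real point `M`, see
`invMap_sub_invMap`. -/
def secondQuotient (M : ℝ) (w : ℂ) : ℂ :=
  -(w * M ^ 2)⁻¹ + ∑ i, (d.eig i : ℂ) ^ 3 / ((1 + w * d.eig i) * (1 + M * d.eig i) ^ 2)
    + ∑ j, (d.weight j : ℂ) * d.hatEig j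
        * ((1 + 2 * M * d.hatEig j) + 2 * (1 + 2 * w * d.hatEig j))
        / ((1 + 2 * w * d.hatEig j) ^ 2 * (1 + 2 * M * d.hatEig j) ^ 3)

/-- The point `M` lies strictly between `0` and every positive pole of `invMap`. -/
structure BeforePoles (M : ℝ) : Prop where
  pos : 0 < M
  eig_pos : ∀ i, 0 < 1 + M * d.eig i
  hatEig_pos : ∀ j, 0 < 1 + 2 * M * d.hatEig j

/-- What is used of the spectral data of a non-reducible polynomial. The eigenvalues of `Â` that
do not contribute to `invMap` are taken to be zero. -/
structure NonReducible : Prop where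
  weight_nonneg : ∀ j, 0 ≤ d.weight j
  le_eig : ∀ j, 0 < d.hatEig j → ∃ i, d.hatEig j ≤ d.eig i
  eig_le : ∀ j, d.hatEig j < 0 → ∃ i, d.eig i ≤ d.hatEig j
  weight_ne : ∀ j, d.hatEig j ≠ 0 → d.weight j ≠ 0
  eig_ne : ∃ i, d.eig i ≠ 0
  rank : (∃ i i', i ≠ i' ∧ d.eig i ≠ 0 ∧ d.eig i' ≠ 0) ∨ ∃ j, d.weight j ≠ 0 ∧ d.hatEig j = 0

variable {d}

omit [Fintype ι] [Fintype κ] in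
lemma BeforePoles.mono {M M' : ℝ} (h : d.BeforePoles M) (h0 : 0 < M') (hle : M' ≤ M) :
    d.BeforePoles M' where
  pos := h0
  eig_pos i := by
    have h1 := h.eig_pos i
    have h2 := h.pos
    by_cases hi : 0 ≤ d.eig i
    · positivity
    · nlinarith
  hatEig_pos j := by
    have h1 := h.hatEig_pos j
    have h2 := h.pos
    by_cases hi : 0 ≤ d.hatEig j
    · positivity
    · nlinarith

/-- Second order expansion of `invMap` around a real point. -/
lemma invMap_sub_invMap {M : ℝ} (hM : d.BeforePoles M) {w : ℂ} (hw : w ≠ 0)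
    (h1 : ∀ i, 1 + w * d.eig i ≠ 0) (h2 : ∀ j, 1 + 2 * w * d.hatEig j ≠ 0) :
    d.invMap w - d.invMap M
      = (w - M) * d.slope M + (w - M) ^ 2 * d.secondQuotient M w := by
  have hM0 : (M : ℂ) ≠ 0 := by exact_mod_cast hM.pos.ne'
  have hM1 : ∀ i, (1 : ℂ) + M * d.eig i ≠ 0 := fun i => by exact_mod_cast (hM.eig_pos i).ne'
  have hM2 : ∀ j, (1 : ℂ) + 2 * M * d.hatEig j ≠ 0 := fun j => by
    exact_mod_cast (hM.hatEig_pos j).ne'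
  have key1 : ∀ a x y : ℂ, 1 + x * a ≠ 0 → 1 + y * a ≠ 0 → a / (1 + x * a) - a / (1 + y * a)
      = (x - y) * -(a ^ 2 / (1 + y * a) ^ 2)
        + (x - y) ^ 2 * (a ^ 3 / ((1 + x * a) * (1 + y * a) ^ 2)) := by
    intro a x y hx hy
    generalize hu : 1 + x * a = u at *
    generalize hv : 1 + y * a = v at *
    field_simp
    simp only [← hu, ← hv]
    ring
  have key2 : ∀ p a x y : ℂ, 1 + 2 * x * a ≠ 0 → 1 + 2 * y * a ≠ 0 →
      -(x * (p * (1 + x * a) / (1 + 2 * x * a) ^ 2))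
        - -(y * (p * (1 + y * a) / (1 + 2 * y * a) ^ 2))
      = (x - y) * -(p / (1 + 2 * y * a) ^ 3)
        + (x - y) ^ 2 * (p * a * ((1 + 2 * y * a) + 2 * (1 + 2 * x * a))
          / ((1 + 2 * x * a) ^ 2 * (1 + 2 * y * a) ^ 3)) := by
    intro p a x y hx hy
    generalize hu : 1 + 2 * x * a = u at *
    generalize hv : 1 + 2 * y * a = v at *
    field_simp
    simp only [← hu, ← hv]
    ring
  have e0 : -w⁻¹ - -(M : ℂ)⁻¹ = (w - M) * (1 / (M : ℂ) ^ 2) + (w - M) ^ 2 * -(w * M ^ 2)⁻¹ := by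
    field_simp
    ring
  have e1 : ∑ i, (d.eig i : ℂ) / (1 + w * d.eig i) - ∑ i, (d.eig i : ℂ) / (1 + M * d.eig i)
      = (w - M) * -(∑ i, (d.eig i : ℂ) ^ 2 / (1 + M * d.eig i) ^ 2)
        + (w - M) ^ 2 * ∑ i, (d.eig i : ℂ) ^ 3 / ((1 + w * d.eig i) * (1 + M * d.eig i) ^ 2) := by
    rw [← Finset.sum_sub_distrib, ← Finset.sum_neg_distrib, Finset.mul_sum, Finset.mul_sum,
      ← Finset.sum_add_distrib]
    exact Finset.sum_congr rfl fun i _ => key1 _ _ _ (h1 i) (hM1 i)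
  have e2 : -(w * ∑ j, (d.weight j : ℂ) * (1 + w * d.hatEig j) / (1 + 2 * w * d.hatEig j) ^ 2)
        - -((M : ℂ) * ∑ j, (d.weight j : ℂ) * (1 + M * d.hatEig j) / (1 + 2 * M * d.hatEig j) ^ 2)
      = (w - M) * -(∑ j, (d.weight j : ℂ) / (1 + 2 * M * d.hatEig j) ^ 3)
        + (w - M) ^ 2 * ∑ j, (d.weight j : ℂ) * d.hatEig j
          * ((1 + 2 * M * d.hatEig j) + 2 * (1 + 2 * w * d.hatEig j))
          / ((1 + 2 * w * d.hatEig j) ^ 2 * (1 + 2 * M * d.hatEig j) ^ 3) := by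
    simp only [← Finset.sum_neg_distrib, Finset.mul_sum]
    rw [← Finset.sum_sub_distrib, ← Finset.sum_add_distrib]
    exact Finset.sum_congr rfl fun j _ => key2 _ _ _ _ (h2 j) (hM2 j)
  simp only [invMap, slope, secondQuotient]
  push_cast
  linear_combination e0 + e1 + e2

lemma invMap_conj (w : ℂ) : d.invMap ((starRingEnd ℂ) w) = (starRingEnd ℂ) (d.invMap w) := by
  simp [invMap, map_sum, map_ofNat]

lemma BeforePoles.eventually_ne {M : ℝ} (hM : d.BeforePoles M) :
    ∀ᶠ w : ℂ in 𝓝 (M : ℂ), w ≠ 0 ∧ (∀ i, 1 + w * d.eig i ≠ 0) ∧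
      ∀ j, 1 + 2 * w * d.hatEig j ≠ 0 := by
  have hM0 : (M : ℂ) ≠ 0 := by exact_mod_cast hM.pos.ne'
  have hM1 : ∀ i, (1 : ℂ) + M * d.eig i ≠ 0 := fun i => by exact_mod_cast (hM.eig_pos i).ne'
  have hM2 : ∀ j, (1 : ℂ) + 2 * M * d.hatEig j ≠ 0 := fun j => by
    exact_mod_cast (hM.hatEig_pos j).ne'
  refine (eventually_ne_nhds hM0).and ((eventually_all.2 fun i => ?_).and
    (eventually_all.2 fun j => ?_))
  · exact ContinuousAt.eventually_ne (g := fun w : ℂ => 1 + w * d.eig i) (by fun_prop) (hM1 i)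
  · exact ContinuousAt.eventually_ne (g := fun w : ℂ => 1 + 2 * w * d.hatEig j) (by fun_prop)
      (hM2 j)

lemma BeforePoles.analyticAt_invMap {M : ℝ} (hM : d.BeforePoles M) :
    AnalyticAt ℂ d.invMap M := by
  have hM0 : (M : ℂ) ≠ 0 := by exact_mod_cast hM.pos.ne'
  have hM1 : ∀ i, (1 : ℂ) + M * d.eig i ≠ 0 := fun i => by exact_mod_cast (hM.eig_pos i).ne'
  have hM2 : ∀ j, ((1 : ℂ) + 2 * M * d.hatEig j) ^ 2 ≠ 0 := fun j => by
    have := (hM.hatEig_pos j).ne'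
    exact pow_ne_zero _ (by exact_mod_cast this)
  unfold invMap
  refine (((analyticAt_id.inv hM0).neg.add ?_).sub (analyticAt_id.mul ?_)).add analyticAt_const
  · exact Finset.analyticAt_fun_sum _ fun i _ =>
      analyticAt_const.div (by fun_prop) (hM1 i)
  · exact Finset.analyticAt_fun_sum _ fun j _ =>
      AnalyticAt.div (by fun_prop) (by fun_prop) (hM2 j)

lemma BeforePoles.analyticAt_secondQuotient {M : ℝ} (hM : d.BeforePoles M) :
    AnalyticAt ℂ (d.secondQuotient M) M := by
  have hM0 : (M : ℂ) ≠ 0 := by exact_mod_cast hM.pos.ne'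
  have hM1 : ∀ i, (1 : ℂ) + M * d.eig i ≠ 0 := fun i => by exact_mod_cast (hM.eig_pos i).ne'
  have hM2 : ∀ j, ((1 : ℂ) + 2 * M * d.hatEig j) ≠ 0 := fun j => by
    exact_mod_cast (hM.hatEig_pos j).ne'
  unfold secondQuotient
  refine AnalyticAt.add (AnalyticAt.add (AnalyticAt.neg (AnalyticAt.inv (by fun_prop) ?_)) ?_) ?_
  · exact mul_ne_zero hM0 (pow_ne_zero _ hM0)
  · exact Finset.analyticAt_fun_sum _ fun i _ =>
      analyticAt_const.div (by fun_prop) (mul_ne_zero (hM1 i) (pow_ne_zero _ (hM1 i)))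
  · exact Finset.analyticAt_fun_sum _ fun j _ =>
      AnalyticAt.div (by fun_prop) (by fun_prop)
        (mul_ne_zero (pow_ne_zero _ (hM2 j)) (pow_ne_zero _ (hM2 j)))

lemma BeforePoles.hasDerivAt_invMap {M : ℝ} (hM : d.BeforePoles M) :
    HasDerivAt d.invMap (d.slope M : ℂ) M := by
  have h1 : HasDerivAt (fun w : ℂ => d.invMap M + ((w - M) * d.slope M
      + (w - M) * ((w - M) * d.secondQuotient M w)))
      (1 * (d.slope M : ℂ) + (1 * (((M : ℂ) - M) * d.secondQuotient M M)
        + ((M : ℂ) - M) * deriv (fun w : ℂ => (w - M) * d.secondQuotient M w) M)) M := by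
    have hi : HasDerivAt (fun w : ℂ => w - M) 1 (M : ℂ) := (hasDerivAt_id _).sub_const _
    refine HasDerivAt.const_add _ ((hi.mul_const _).add (hi.mul ?_))
    exact (hi.differentiableAt.mul
      hM.analyticAt_secondQuotient.differentiableAt).hasDerivAt
  simp only [sub_self, zero_mul, mul_zero, add_zero, one_mul] at h1
  refine h1.congr_of_eventuallyEq ?_
  filter_upwards [hM.eventually_ne] with w hw
  linear_combination invMap_sub_invMap hM hw.1 hw.2.1 hw.2.2

/-- The value of `secondQuotient` on the diagonal, multiplied with `M ^ 3`, at a critical point. -/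
lemma secondQuotient_self {M : ℝ} (hM : d.BeforePoles M) (hs : d.slope M = 0) :
    d.secondQuotient M M = ((-(∑ i, (M * d.eig i) ^ 2 / (1 + M * d.eig i) ^ 3
      + ∑ j, M ^ 2 * d.weight j * (1 - M * d.hatEig j) / (1 + 2 * M * d.hatEig j) ^ 4) / M ^ 3 : ℝ)
        : ℂ) := by
  have hM0 : M ≠ 0 := hM.pos.ne'
  have e : d.secondQuotient M M = ((-(M * M ^ 2)⁻¹
      + ∑ i, d.eig i ^ 3 / ((1 + M * d.eig i) * (1 + M * d.eig i) ^ 2)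
      + ∑ j, d.weight j * d.hatEig j
        * ((1 + 2 * M * d.hatEig j) + 2 * (1 + 2 * M * d.hatEig j))
        / ((1 + 2 * M * d.hatEig j) ^ 2 * (1 + 2 * M * d.hatEig j) ^ 3) : ℝ) : ℂ) := by
    simp only [secondQuotient]
    push_cast
    rfl
  rw [e]
  congr 1
  have h0 : 1 / M ^ 2 = ∑ i, d.eig i ^ 2 / (1 + M * d.eig i) ^ 2
      + ∑ j, d.weight j / (1 + 2 * M * d.hatEig j) ^ 3 := by
    simp only [slope] at hs
    linarith
  have h1 : -(M * M ^ 2)⁻¹ = -(M⁻¹ * (1 / M ^ 2)) := by field_simp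
  rw [h1, h0, neg_div, add_div, mul_add, Finset.mul_sum, Finset.mul_sum, Finset.sum_div,
    Finset.sum_div]
  have e1 : ∑ i, d.eig i ^ 3 / ((1 + M * d.eig i) * (1 + M * d.eig i) ^ 2)
      = ∑ i, M⁻¹ * (d.eig i ^ 2 / (1 + M * d.eig i) ^ 2)
        - ∑ i, (M * d.eig i) ^ 2 / (1 + M * d.eig i) ^ 3 / M ^ 3 := by
    rw [← Finset.sum_sub_distrib]
    refine Finset.sum_congr rfl fun i _ => ?_
    have := (hM.eig_pos i).ne'
    field_simp
    ring
  have e2 : ∑ j, d.weight j * d.hatEig j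
        * ((1 + 2 * M * d.hatEig j) + 2 * (1 + 2 * M * d.hatEig j))
        / ((1 + 2 * M * d.hatEig j) ^ 2 * (1 + 2 * M * d.hatEig j) ^ 3)
      = ∑ j, M⁻¹ * (d.weight j / (1 + 2 * M * d.hatEig j) ^ 3)
        - ∑ j, M ^ 2 * d.weight j * (1 - M * d.hatEig j) / (1 + 2 * M * d.hatEig j) ^ 4 / M ^ 3 := by
    rw [← Finset.sum_sub_distrib]
    refine Finset.sum_congr rfl fun j _ => ?_
    have := (hM.hatEig_pos j).ne'
    field_simp
    ring
  rw [e1, e2]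
  ring

/-- A critical point of `invMap` before the poles is a non-degenerate local maximum. -/
lemma NonReducible.secondQuotient_neg (hd : d.NonReducible) {M : ℝ} (hM : d.BeforePoles M)
    (hs : d.slope M = 0) : ∃ k : ℝ, 0 < k ∧ d.secondQuotient M M = -(k : ℂ) := by
  have hM0 := hM.pos
  refine ⟨(∑ i, (M * d.eig i) ^ 2 / (1 + M * d.eig i) ^ 3
      + ∑ j, M ^ 2 * d.weight j * (1 - M * d.hatEig j) / (1 + 2 * M * d.hatEig j) ^ 4) / M ^ 3,
      div_pos ?_ (by positivity), ?_⟩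
  swap
  · rw [secondQuotient_self hM hs, neg_div]
    push_cast
    rfl
  have hnn : ∀ i, 0 ≤ (M * d.eig i) ^ 2 / (1 + M * d.eig i) ^ 3 := fun i => by
    have := hM.eig_pos i
    positivity
  obtain ⟨i₀, hi₀⟩ := hd.eig_ne
  obtain ⟨i₁, -, hmax⟩ := Finset.exists_max_image Finset.univ d.eig ⟨i₀, Finset.mem_univ _⟩
  by_cases ha : M * d.eig i₁ ≤ 1
  · have hle : ∀ j, M * d.hatEig j ≤ 1 := fun j => by
      by_cases hj : 0 < d.hatEig j
      · obtain ⟨i, hi⟩ := hd.le_eig j hj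
        have := hmax i (Finset.mem_univ _)
        nlinarith
      · nlinarith
    refine add_pos_of_pos_of_nonneg (Finset.sum_pos' (fun i _ => hnn i)
      ⟨i₀, Finset.mem_univ _, ?_⟩) (Finset.sum_nonneg fun j _ => ?_)
    · have := hM.eig_pos i₀
      positivity
    · have := hM.hatEig_pos j
      have := hd.weight_nonneg j
      have : 0 ≤ 1 - M * d.hatEig j := by linarith [hle j]
      positivity
  · push Not at ha
    set a := M * d.eig i₁ with ha_def
    have hF : ∑ i, (M * d.eig i) ^ 2 / (1 + M * d.eig i) ^ 2
        + ∑ j, M ^ 2 * d.weight j / (1 + 2 * M * d.hatEig j) ^ 3 = 1 := by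
      have h0 : M ^ 2 * d.slope M = 0 := by rw [hs, mul_zero]
      simp only [slope, mul_sub, Finset.mul_sum] at h0
      have h1 : M ^ 2 * (1 / M ^ 2) = 1 := by field_simp
      have h2 : ∑ i, M ^ 2 * (d.eig i ^ 2 / (1 + M * d.eig i) ^ 2)
          = ∑ i, (M * d.eig i) ^ 2 / (1 + M * d.eig i) ^ 2 :=
        Finset.sum_congr rfl fun i _ => by ring
      have h3 : ∑ j, M ^ 2 * (d.weight j / (1 + 2 * M * d.hatEig j) ^ 3)
          = ∑ j, M ^ 2 * d.weight j / (1 + 2 * M * d.hatEig j) ^ 3 :=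
        Finset.sum_congr rfl fun i _ => by ring
      linarith
    have h1 : a ^ 2 / (1 + a) ^ 2 ≤ ∑ i, (M * d.eig i) ^ 2 / (1 + M * d.eig i) ^ 2 :=
      Finset.single_le_sum (f := fun i => (M * d.eig i) ^ 2 / (1 + M * d.eig i) ^ 2)
        (fun i _ => by positivity) (Finset.mem_univ i₁)
    have h2 : a ^ 2 / (1 + a) ^ 3 ≤ ∑ i, (M * d.eig i) ^ 2 / (1 + M * d.eig i) ^ 3 :=
      Finset.single_le_sum (f := fun i => (M * d.eig i) ^ 2 / (1 + M * d.eig i) ^ 3)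
        (fun i _ => hnn i) (Finset.mem_univ i₁)
    -- `s ↦ (1 - s) / (1 + 2 s)` decreases, and `Â` has no eigenvalue above those of `A`
    have h3 : (1 - a) / (1 + 2 * a) * ∑ j, M ^ 2 * d.weight j / (1 + 2 * M * d.hatEig j) ^ 3
        ≤ ∑ j, M ^ 2 * d.weight j * (1 - M * d.hatEig j) / (1 + 2 * M * d.hatEig j) ^ 4 := by
      rw [Finset.mul_sum]
      refine Finset.sum_le_sum fun j _ => ?_
      have hj := hM.hatEig_pos j
      have hw := hd.weight_nonneg j
      have hle : M * d.hatEig j ≤ a := by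
        by_cases hj : 0 < d.hatEig j
        · obtain ⟨i, hi⟩ := hd.le_eig j hj
          have := hmax i (Finset.mem_univ _)
          nlinarith
        · nlinarith
      have e : M ^ 2 * d.weight j * (1 - M * d.hatEig j) / (1 + 2 * M * d.hatEig j) ^ 4
          = (1 - M * d.hatEig j) / (1 + 2 * M * d.hatEig j)
            * (M ^ 2 * d.weight j / (1 + 2 * M * d.hatEig j) ^ 3) := by
        field_simp
      rw [e]
      refine mul_le_mul_of_nonneg_right ?_ (by positivity)
      rw [div_le_div_iff₀ (by linarith) hj]
      nlinarith
    have h4 : (1 - a) / (1 + 2 * a) * (1 - a ^ 2 / (1 + a) ^ 2)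
        ≤ (1 - a) / (1 + 2 * a) * ∑ j, M ^ 2 * d.weight j / (1 + 2 * M * d.hatEig j) ^ 3 := by
      refine mul_le_mul_of_nonpos_left (by linarith) ?_
      exact div_nonpos_of_nonpos_of_nonneg (by linarith) (by linarith)
    have h5 : a ^ 2 / (1 + a) ^ 3 + (1 - a) / (1 + 2 * a) * (1 - a ^ 2 / (1 + a) ^ 2)
        = 1 / (1 + a) ^ 3 := by
      have : 1 + a ≠ 0 := by positivity
      have : 1 + 2 * a ≠ 0 := by positivity
      field_simp
      ring
    have h6 : 0 < 1 / (1 + a) ^ 3 := by positivity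
    linarith

lemma slope_neg_of_one_lt {w : ℝ} (hw : 0 < w)
    (h : 1 < ∑ i, (w * d.eig i) ^ 2 / (1 + w * d.eig i) ^ 2
      + ∑ j, w ^ 2 * d.weight j / (1 + 2 * w * d.hatEig j) ^ 3) : d.slope w < 0 := by
  have e : d.slope w = (1 - (∑ i, (w * d.eig i) ^ 2 / (1 + w * d.eig i) ^ 2
      + ∑ j, w ^ 2 * d.weight j / (1 + 2 * w * d.hatEig j) ^ 3)) / w ^ 2 := by
    have h2 : ∑ i, (w * d.eig i) ^ 2 / (1 + w * d.eig i) ^ 2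
        = w ^ 2 * ∑ i, d.eig i ^ 2 / (1 + w * d.eig i) ^ 2 := by
      rw [Finset.mul_sum]
      exact Finset.sum_congr rfl fun i _ => by ring
    have h3 : ∑ j, w ^ 2 * d.weight j / (1 + 2 * w * d.hatEig j) ^ 3
        = w ^ 2 * ∑ j, d.weight j / (1 + 2 * w * d.hatEig j) ^ 3 := by
      rw [Finset.mul_sum]
      exact Finset.sum_congr rfl fun i _ => by ring
    rw [h2, h3, slope]
    field_simp
    ring
  rw [e]
  exact div_neg_of_neg_of_pos (by linarith) (by positivity)

/-- The derivative of `invMap` becomes negative before the first pole. -/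
lemma NonReducible.exists_slope_neg (hd : d.NonReducible) :
    ∃ w, d.BeforePoles w ∧ d.slope w < 0 := by
  have hterm : ∀ {w}, d.BeforePoles w → ∀ j,
      0 ≤ w ^ 2 * d.weight j / (1 + 2 * w * d.hatEig j) ^ 3 := fun hw j => by
    have := hw.hatEig_pos j
    have := hd.weight_nonneg j
    positivity
  have hterm' : ∀ {w} i, 0 ≤ (w * d.eig i) ^ 2 / (1 + w * d.eig i) ^ 2 := fun i => by
    positivity
  obtain ⟨i₀, hi₀⟩ := hd.eig_ne
  by_cases hneg : ∃ i, d.eig i < 0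
  · -- the first pole is at `1 / K`
    obtain ⟨K, hK1, hK2, hK⟩ : ∃ K, (∀ i, -d.eig i ≤ K) ∧ (∀ j, -(2 * d.hatEig j) ≤ K) ∧
        ((∃ i, K = -d.eig i) ∨ ∃ j, K = -(2 * d.hatEig j)) := by
      let f : ι ⊕ κ → ℝ := Sum.elim (fun i => -d.eig i) (fun j => -(2 * d.hatEig j))
      obtain ⟨x, -, hx⟩ := Finset.exists_max_image Finset.univ f ⟨Sum.inl i₀, Finset.mem_univ _⟩
      refine ⟨f x, fun i => hx (Sum.inl i) (Finset.mem_univ _),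
        fun j => hx (Sum.inr j) (Finset.mem_univ _), ?_⟩
      rcases x with i | j
      · exact Or.inl ⟨i, rfl⟩
      · exact Or.inr ⟨j, rfl⟩
    have hKpos : 0 < K := by
      obtain ⟨i, hi⟩ := hneg
      linarith [hK1 i]
    have hbp : ∀ t, 0 < t → t < 1 → d.BeforePoles (t / K) := fun t ht0 ht1 => by
      refine ⟨by positivity, fun i => ?_, fun j => ?_⟩
      · have : 1 + t / K * d.eig i = ((K - t * K) + t * (K + d.eig i)) / K := by
          field_simp
          ring
        rw [this]
        have := hK1 i
        exact div_pos (by nlinarith) hKpos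
      · have : 1 + 2 * (t / K) * d.hatEig j = ((K - t * K) + t * (K + 2 * d.hatEig j)) / K := by
          field_simp
          ring
        rw [this]
        have := hK2 j
        exact div_pos (by nlinarith) hKpos
    rcases hK with ⟨i, hi⟩ | ⟨j, hj⟩
    · -- the summand of the eigenvalue `-K` has the value `4` at `2 / (3 K)`
      have hb := hbp (2 / 3) (by norm_num) (by norm_num)
      refine ⟨_, hb, slope_neg_of_one_lt hb.pos ?_⟩
      have h1 := Finset.single_le_sum
        (f := fun i => ((2 / 3) / K * d.eig i) ^ 2 / (1 + (2 / 3) / K * d.eig i) ^ 2)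
        (fun i _ => hterm' i) (Finset.mem_univ i)
      have h2 := Finset.sum_nonneg fun j (_ : j ∈ Finset.univ) => hterm hb j
      have h3 : (2 / 3) / K * d.eig i = -(2 / 3) := by
        rw [show d.eig i = -K by linarith]
        field_simp
      simp only [h3] at h1
      norm_num at h1
      linarith
    · have hwj : 0 < d.weight j :=
        lt_of_le_of_ne (hd.weight_nonneg j) (hd.weight_ne j (by linarith)).symm
      -- `ε` is the relative distance to the pole
      set ε := min (1 / 2) (d.weight j / (2 * K ^ 2)) with hε
      have hε0 : 0 < ε := lt_min (by norm_num) (by positivity)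
      have hε1 : ε ≤ 1 / 2 := min_le_left _ _
      have hε2 : ε ≤ d.weight j / (2 * K ^ 2) := min_le_right _ _
      have hb := hbp (1 - ε) (by linarith) (by linarith)
      refine ⟨_, hb, slope_neg_of_one_lt hb.pos ?_⟩
      have h1 := Finset.single_le_sum
        (f := fun j => ((1 - ε) / K) ^ 2 * d.weight j / (1 + 2 * ((1 - ε) / K) * d.hatEig j) ^ 3)
        (fun j _ => hterm hb j) (Finset.mem_univ j)
      have h2 := Finset.sum_nonneg fun i (_ : i ∈ Finset.univ) => hterm' (w := (1 - ε) / K) i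
      have h3 : 1 + 2 * ((1 - ε) / K) * d.hatEig j = ε := by
        rw [show d.hatEig j = -K / 2 by linarith]
        field_simp
        ring
      simp only [h3] at h1
      have h4 : 1 < ((1 - ε) / K) ^ 2 * d.weight j / ε ^ 3 := by
        have h5 : ε * (2 * K ^ 2) ≤ d.weight j := (le_div_iff₀ (by positivity)).1 hε2
        have h6 : ((1 - ε) / K) ^ 2 * d.weight j ≥ ((1 - ε) / K) ^ 2 * (ε * (2 * K ^ 2)) := by
          gcongr
        have h7 : ((1 - ε) / K) ^ 2 * (ε * (2 * K ^ 2)) = 2 * ε * (1 - ε) ^ 2 := by field_simp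
        rw [lt_div_iff₀ (by positivity)]
        nlinarith [mul_pos hε0 hε0]
      linarith
  · push Not at hneg
    have hneg' : ∀ j, 0 ≤ d.hatEig j := fun j => by
      by_contra hj
      push Not at hj
      obtain ⟨i, hi⟩ := hd.eig_le j hj
      linarith [hneg i]
    have hb : ∀ {w}, 0 < w → d.BeforePoles w := fun hw =>
      ⟨hw, fun i => by have := hneg i; positivity, fun j => by have := hneg' j; positivity⟩
    -- without positive poles, the sums are large at large points
    rcases hd.rank with ⟨i, i', hii, hi, hi'⟩ | ⟨j, hj, hj0⟩
    · have hi : 0 < d.eig i := lt_of_le_of_ne (hneg i) hi.symm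
      have hi' : 0 < d.eig i' := lt_of_le_of_ne (hneg i') hi'.symm
      set w := 3 / d.eig i + 3 / d.eig i' with hw
      have hw0 : 0 < w := by positivity
      refine ⟨w, hb hw0, slope_neg_of_one_lt hw0 ?_⟩
      classical
      have h1 : ∑ k ∈ ({i, i'} : Finset ι), (w * d.eig k) ^ 2 / (1 + w * d.eig k) ^ 2
          ≤ ∑ k, (w * d.eig k) ^ 2 / (1 + w * d.eig k) ^ 2 :=
        Finset.sum_le_sum_of_subset_of_nonneg (Finset.subset_univ _) fun k _ _ => hterm' k
      rw [Finset.sum_pair hii] at h1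
      have h2 := Finset.sum_nonneg fun j (_ : j ∈ Finset.univ) => hterm (hb hw0) j
      have h3 : ∀ a : ℝ, 3 ≤ a → 1 / 2 < a ^ 2 / (1 + a) ^ 2 := fun a ha => by
        rw [lt_div_iff₀ (by positivity)]
        nlinarith
      have h4 : 3 ≤ w * d.eig i := by
        have : w * d.eig i = 3 + 3 / d.eig i' * d.eig i := by rw [hw]; field_simp
        rw [this]
        have : 0 < 3 / d.eig i' * d.eig i := by positivity
        linarith
      have h5 : 3 ≤ w * d.eig i' := by
        have : w * d.eig i' = 3 + 3 / d.eig i * d.eig i' := by rw [hw]; field_simp; ring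
        rw [this]
        have : 0 < 3 / d.eig i * d.eig i' := by positivity
        linarith
      linarith [h3 _ h4, h3 _ h5]
    · have hwj : 0 < d.weight j := lt_of_le_of_ne (hd.weight_nonneg j) hj.symm
      set w := 1 + 1 / d.weight j with hw
      have hw0 : 0 < w := by positivity
      refine ⟨w, hb hw0, slope_neg_of_one_lt hw0 ?_⟩
      have h1 := Finset.single_le_sum
        (f := fun j => w ^ 2 * d.weight j / (1 + 2 * w * d.hatEig j) ^ 3)
        (fun j _ => hterm (hb hw0) j) (Finset.mem_univ j)
      have h2 := Finset.sum_nonneg fun i (_ : i ∈ Finset.univ) => hterm' (w := w) i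
      simp only [hj0, mul_zero, add_zero, one_pow, div_one] at h1
      have h3 : w * d.weight j = d.weight j + 1 := by rw [hw]; field_simp
      have h4 : 1 < w := by rw [hw]; have : 0 < 1 / d.weight j := by positivity
                            linarith
      nlinarith

variable (d) in
/-- The spectral data of the polynomial `-q`. -/
def neg : SpectralData ι κ where
  eig i := -d.eig i
  weight := d.weight
  hatEig j := -d.hatEig j
  shift := -d.shift

lemma invMap_neg (w : ℂ) : d.neg.invMap w = -d.invMap (-w) := by
  simp only [invMap, neg, Complex.ofReal_neg, mul_neg, neg_mul, inv_neg, neg_neg, neg_div,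
    Finset.sum_neg_distrib]
  ring

omit [Fintype ι] [Fintype κ] in
lemma NonReducible.neg (hd : d.NonReducible) : d.neg.NonReducible where
  weight_nonneg := hd.weight_nonneg
  le_eig j hj := by
    obtain ⟨i, hi⟩ := hd.eig_le j (neg_pos.1 hj)
    exact ⟨i, neg_le_neg hi⟩
  eig_le j hj := by
    obtain ⟨i, hi⟩ := hd.le_eig j (neg_neg_iff_pos.1 hj)
    exact ⟨i, neg_le_neg hi⟩
  weight_ne j hj := hd.weight_ne j fun h => hj (by simp [SpectralData.neg, h])
  eig_ne := by
    obtain ⟨i, hi⟩ := hd.eig_ne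
    exact ⟨i, neg_ne_zero.2 hi⟩
  rank := by
    rcases hd.rank with ⟨i, i', h, hi, hi'⟩ | ⟨j, hj, hj0⟩
    · exact Or.inl ⟨i, i', h, neg_ne_zero.2 hi, neg_ne_zero.2 hi'⟩
    · exact Or.inr ⟨j, hj, by simp [SpectralData.neg, hj0]⟩

/-- Near the origin `invMap` differs from `-1 / w` by a function that is Lipschitz continuous and
commutes with complex conjugation, so that it expands imaginary parts there. -/
lemma eventually_im_le_im_invMap :
    ∀ᶠ w : ℂ in 𝓝 0, 0 < w.im → w.im ≤ (d.invMap w).im := by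
  set φ : ℂ → ℂ := fun w => ∑ i, (d.eig i : ℂ) / (1 + w * d.eig i)
    - w * ∑ j, (d.weight j : ℂ) * (1 + w * d.hatEig j) / (1 + 2 * w * d.hatEig j) ^ 2 + d.shift
    with hφ
  have hφ_conj : ∀ w, φ ((starRingEnd ℂ) w) = (starRingEnd ℂ) (φ w) := fun w => by
    simp [hφ, map_sum, map_ofNat]
  have hφa : AnalyticAt ℂ φ 0 := by
    refine AnalyticAt.add (AnalyticAt.sub ?_ (analyticAt_id.mul ?_)) analyticAt_const
    · exact Finset.analyticAt_fun_sum _ fun i _ =>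
        analyticAt_const.div (by fun_prop) (by simp)
    · exact Finset.analyticAt_fun_sum _ fun j _ =>
        AnalyticAt.div (by fun_prop) (by fun_prop) (by simp)
  obtain ⟨K, s, hs, hK⟩ := hφa.hasStrictFDerivAt.exists_lipschitzOnWith
  have hconj : Tendsto (starRingEnd ℂ) (𝓝 0) (𝓝 (0 : ℂ)) := by
    simpa using (Complex.continuous_conj.tendsto (0 : ℂ))
  have hsmall : ∀ᶠ w : ℂ in 𝓝 0, ‖w‖ ^ 2 * (K + 1) < 1 := by
    have : ContinuousAt (fun w : ℂ => ‖w‖ ^ 2 * ((K : ℝ) + 1)) 0 := by fun_prop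
    exact this.eventually_lt continuousAt_const (by simp)
  filter_upwards [hs, hconj hs, hsmall] with w hw hw' hlt him
  have h1 : |(φ w).im| ≤ K * w.im := by
    have h := hK.dist_le_mul w hw _ hw'
    rw [hφ_conj, dist_comm, Complex.dist_conj_self, dist_comm w, Complex.dist_conj_self,
      abs_of_pos him] at h
    linarith
  have h2 : d.invMap w = -w⁻¹ + φ w := by
    simp only [invMap, hφ]
    ring
  have hw0 : w ≠ 0 := fun h => by simp [h] at him
  have hn : 0 < Complex.normSq w := Complex.normSq_pos.2 hw0
  rw [h2, Complex.add_im, Complex.neg_im, Complex.inv_im, neg_div, neg_neg]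
  have h3 : w.im * (K + 1) ≤ w.im / Complex.normSq w := by
    rw [le_div_iff₀ hn, Complex.normSq_eq_norm_sq]
    nlinarith
  have h4 := (abs_le.1 h1).1
  nlinarith

end SpectralData

/-! ### Stieltjes transforms -/

lemma mem_upper {z : ℂ} : z ∈ upper ↔ 0 < z.im := Iff.rfl

lemma isOpen_upper : IsOpen upper := isOpen_lt continuous_const Complex.continuous_im

lemma convex_upper : Convex ℝ upper := convex_halfSpace_im_gt 0

lemma tendsto_mk_upper (E : ℝ) :
    Tendsto (fun η : ℝ => (⟨E, η⟩ : ℂ)) (𝓝[>] 0) (𝓝[upper] (E : ℂ)) := by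
  refine tendsto_nhdsWithin_iff.2 ⟨?_, ?_⟩
  · have h : Continuous fun η : ℝ => ((E : ℂ) + η * Complex.I) := by fun_prop
    have h2 := (h.tendsto 0).mono_left (nhdsWithin_le_nhds (s := Set.Ioi 0))
    simp only [Complex.ofReal_zero, zero_mul, add_zero] at h2
    refine h2.congr fun η => ?_
    apply Complex.ext <;> simp
  · filter_upwards [self_mem_nhdsWithin] with η hη
    exact hη

section

variable (ρ : Measure ℝ) [IsProbabilityMeasure ρ]

lemma norm_inv_ofReal_sub_le {z : ℂ} (hz : z ∈ upper) (x : ℝ) :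
    ‖((x : ℂ) - z)⁻¹‖ ≤ z.im⁻¹ := by
  rw [norm_inv]
  refine inv_anti₀ hz ?_
  have h := Complex.abs_im_le_norm ((x : ℂ) - z)
  simp only [Complex.sub_im, Complex.ofReal_im, zero_sub, abs_neg] at h
  exact (le_abs_self _).trans h

lemma integrable_stieltjes_kernel {z : ℂ} (hz : z ∈ upper) :
    Integrable (fun x : ℝ => ((x : ℂ) - z)⁻¹) ρ :=
  Integrable.of_bound (by fun_prop) z.im⁻¹ (ae_of_all _ fun x => norm_inv_ofReal_sub_le hz x)

/-- The imaginary part of the Stieltjes transform is the Poisson integral of the measure. -/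
lemma im_stieltjes {z : ℂ} (hz : z ∈ upper) :
    (stieltjes ρ z).im = ∫ x : ℝ, z.im / ((x - z.re) ^ 2 + z.im ^ 2) ∂ρ := by
  rw [stieltjes, ← RCLike.im_to_complex, ← integral_im (integrable_stieltjes_kernel ρ hz)]
  refine integral_congr_ae (ae_of_all _ fun x => ?_)
  simp only [RCLike.im_to_complex, Complex.inv_im, Complex.normSq_apply, Complex.sub_im,
    Complex.ofReal_im, Complex.sub_re, Complex.ofReal_re]
  ring

lemma integral_poisson_kernel (a b x : ℝ) {η : ℝ} (hη : 0 < η) :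
    ∫ E in a..b, η / ((x - E) ^ 2 + η ^ 2)
      = Real.arctan ((b - x) / η) - Real.arctan ((a - x) / η) := by
  have h : ∀ E, HasDerivAt (fun E => Real.arctan ((E - x) / η)) (η / ((x - E) ^ 2 + η ^ 2)) E := by
    intro E
    have h1 : HasDerivAt (fun E => (E - x) / η) (1 / η) E :=
      ((hasDerivAt_id E).sub_const x).div_const η
    convert h1.arctan using 1
    have : (0 : ℝ) < (x - E) ^ 2 + η ^ 2 := by positivity
    have : (0 : ℝ) < 1 + ((E - x) / η) ^ 2 := by positivity
    field_simp
    ring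
  have hc : Continuous fun E => η / ((x - E) ^ 2 + η ^ 2) :=
    continuous_const.div (by fun_prop) fun E => by positivity
  exact intervalIntegral.integral_eq_sub_of_hasDerivAt (fun E _ => h E) (hc.intervalIntegrable _ _)

lemma intervalIntegral_im_stieltjes (a b : ℝ) {η : ℝ} (hη : 0 < η) :
    ∫ E in a..b, (stieltjes ρ ⟨E, η⟩).im
      = ∫ x, (Real.arctan ((b - x) / η) - Real.arctan ((a - x) / η)) ∂ρ := by
  have h1 : ∀ E, (stieltjes ρ ⟨E, η⟩).im = ∫ x : ℝ, η / ((x - E) ^ 2 + η ^ 2) ∂ρ := fun E =>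
    im_stieltjes ρ (z := ⟨E, η⟩) hη
  simp only [h1, ← integral_poisson_kernel a b _ hη]
  refine intervalIntegral_integral_swap ?_
  have : IsFiniteMeasure (volume.restrict (Set.uIoc a b)) := ⟨by simp [Set.uIoc]⟩
  have hc : Continuous (Function.uncurry fun E x : ℝ => η / ((x - E) ^ 2 + η ^ 2)) :=
    continuous_const.div (by fun_prop) fun p => by positivity
  refine Integrable.of_bound hc.aestronglyMeasurable η⁻¹ (ae_of_all _ fun p => ?_)
  simp only [Function.uncurry]
  rw [Real.norm_of_nonneg (by positivity), div_le_iff₀ (by positivity)]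
  have : η⁻¹ * ((p.2 - p.1) ^ 2 + η ^ 2) = η⁻¹ * (p.2 - p.1) ^ 2 + η := by field_simp
  rw [this]
  have : 0 ≤ η⁻¹ * (p.2 - p.1) ^ 2 := by positivity
  linarith

lemma tendsto_arctan_div (t : ℝ) :
    Tendsto (fun η : ℝ => Real.arctan (t / η)) (𝓝[>] 0)
      (𝓝 (if 0 < t then Real.pi / 2 else if t < 0 then -(Real.pi / 2) else 0)) := by
  have hinv : Tendsto (fun η : ℝ => η⁻¹) (𝓝[>] 0) atTop := tendsto_inv_nhdsGT_zero
  split_ifs with h1 h2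
  · exact (Real.tendsto_arctan_atTop.mono_right nhdsWithin_le_nhds).comp
      (hinv.const_mul_atTop h1)
  · exact (Real.tendsto_arctan_atBot.mono_right nhdsWithin_le_nhds).comp
      (hinv.const_mul_atTop_of_neg h2)
  · have : t = 0 := le_antisymm (not_lt.1 h1) (not_lt.1 h2)
    simp [this]

/-- The limit of the averaged Poisson integrals over an interval, up to the contribution of the
end points. -/
lemma exists_tendsto_intervalIntegral_im_stieltjes {a b : ℝ} (hab : a ≤ b) :
    ∃ I, Tendsto (fun η : ℝ => ∫ E in a..b, (stieltjes ρ ⟨E, η⟩).im) (𝓝[>] 0) (𝓝 I) ∧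
      Real.pi * ρ.real (Set.Ioo a b) ≤ I ∧ I ≤ Real.pi * ρ.real (Set.Icc a b) := by
  have hpi := Real.pi_pos
  set s : ℝ → ℝ := fun t => if 0 < t then Real.pi / 2 else if t < 0 then -(Real.pi / 2) else 0
    with hs
  have hsm : Measurable s := by
    refine Measurable.ite measurableSet_Ioi measurable_const ?_
    exact Measurable.ite measurableSet_Iio measurable_const measurable_const
  have hsb : ∀ t, |s t| ≤ Real.pi / 2 := fun t => by
    simp only [hs]
    split_ifs <;> simp [abs_of_pos, hpi]
    positivity
  have hint : Integrable (fun x => s (b - x) - s (a - x)) ρ := by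
    refine Integrable.of_bound (by fun_prop) (Real.pi / 2 + Real.pi / 2)
      (ae_of_all _ fun x => ?_)
    exact (norm_sub_le _ _).trans (add_le_add (hsb _) (hsb _))
  refine ⟨∫ x, (s (b - x) - s (a - x)) ∂ρ, ?_, ?_, ?_⟩
  · have h : Tendsto (fun η : ℝ => ∫ x, (Real.arctan ((b - x) / η) - Real.arctan ((a - x) / η)) ∂ρ)
        (𝓝[>] 0) (𝓝 (∫ x, (s (b - x) - s (a - x)) ∂ρ)) := by
      refine tendsto_integral_filter_of_dominated_convergence
        (fun _ => Real.pi / 2 + Real.pi / 2) ?_ ?_ (integrable_const _) ?_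
      · exact Eventually.of_forall fun η => (by fun_prop : Measurable _).aestronglyMeasurable
      · have hb : ∀ t, ‖Real.arctan t‖ ≤ Real.pi / 2 := fun t =>
          abs_le.2 ⟨(Real.neg_pi_div_two_lt_arctan t).le, (Real.arctan_lt_pi_div_two t).le⟩
        exact Eventually.of_forall fun η => ae_of_all _ fun x =>
          (norm_sub_le _ _).trans (add_le_add (hb _) (hb _))
      · exact ae_of_all _ fun x => (tendsto_arctan_div _).sub (tendsto_arctan_div _)
    refine h.congr' ?_
    filter_upwards [self_mem_nhdsWithin] with η hη
    exact (intervalIntegral_im_stieltjes ρ a b hη).symm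
  · rw [mul_comm, ← smul_eq_mul, ← setIntegral_const, ← integral_indicator measurableSet_Ioo]
    refine integral_mono ((integrable_const _).indicator measurableSet_Ioo) hint fun x => ?_
    simp only [Set.indicator_apply, Set.mem_Ioo, hs]
    split_ifs <;> linarith
  · rw [mul_comm, ← smul_eq_mul, ← setIntegral_const, ← integral_indicator measurableSet_Icc]
    refine integral_mono hint ((integrable_const _).indicator measurableSet_Icc) fun x => ?_
    simp only [Set.indicator_apply, Set.mem_Icc, hs]
    split_ifs <;> first | linarith | (exfalso; simp_all; done) | (exfalso; simp_all; linarith)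

/-- **Stieltjes inversion**: bounded boundary values of the imaginary part of the Stieltjes
transform on an interval are, up to the factor `π`, the density of the measure there. -/
theorem restrict_Ioo_eq_withDensity {a b C : ℝ} {f : ℝ → ℝ} (hf : Measurable f)
    (hC : ∀ᶠ η in 𝓝[>] (0 : ℝ), ∀ E ∈ Set.Ioo a b, (stieltjes ρ ⟨E, η⟩).im ≤ C)
    (hlim : ∀ E ∈ Set.Ioo a b,
      Tendsto (fun η : ℝ => (stieltjes ρ ⟨E, η⟩).im) (𝓝[>] 0) (𝓝 (f E))) :
    ρ.restrict (Set.Ioo a b) =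
      (volume.restrict (Set.Ioo a b)).withDensity fun x => ENNReal.ofReal (f x / Real.pi) := by
  have hpi := Real.pi_pos
  have hpos : ∀ {η : ℝ}, 0 < η → ∀ E, 0 ≤ (stieltjes ρ ⟨E, η⟩).im := fun {η} hη E => by
    rw [im_stieltjes ρ (z := ⟨E, η⟩) hη]
    exact integral_nonneg fun x => by
      simp only [Pi.zero_apply]
      positivity
  have hf0 : ∀ E ∈ Set.Ioo a b, 0 ≤ f E := fun E hE =>
    ge_of_tendsto (hlim E hE) (by
      filter_upwards [self_mem_nhdsWithin] with η hη
      exact hpos hη E)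
  have hfC : ∀ E ∈ Set.Ioo a b, f E ≤ C := fun E hE =>
    le_of_tendsto (hlim E hE) (hC.mono fun η hη => hη E hE)
  have hfi : ∀ {p q : ℝ}, Set.Ioo p q ⊆ Set.Ioo a b → IntegrableOn f (Set.Ioo p q) := by
    intro p q hpq
    refine Measure.integrableOn_of_bounded (M := C) (by simp) hf.aestronglyMeasurable ?_
    filter_upwards [ae_restrict_mem measurableSet_Ioo] with E hE
    rw [Real.norm_of_nonneg (hf0 E (hpq hE))]
    exact hfC E (hpq hE)
  -- dominated convergence on an interval
  have hconv : ∀ {p q : ℝ}, p ≤ q → Set.Ioo p q ⊆ Set.Ioo a b →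
      Real.pi * ρ.real (Set.Ioo p q) ≤ ∫ E in Set.Ioo p q, f E ∧
        ∫ E in Set.Ioo p q, f E ≤ Real.pi * ρ.real (Set.Icc p q) := by
    intro p q hpq hsub
    obtain ⟨I, hI, h1, h2⟩ := exists_tendsto_intervalIntegral_im_stieltjes ρ hpq
    have h3 : Tendsto (fun η : ℝ => ∫ E in p..q, (stieltjes ρ ⟨E, η⟩).im) (𝓝[>] 0)
        (𝓝 (∫ E in Set.Ioo p q, f E)) := by
      simp only [intervalIntegral.integral_of_le hpq, integral_Ioc_eq_integral_Ioo]
      refine tendsto_integral_filter_of_dominated_convergence (fun _ => C) ?_ ?_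
        (integrable_const _) ?_
      · filter_upwards [self_mem_nhdsWithin] with η hη
        have : (fun E : ℝ => (stieltjes ρ ⟨E, η⟩).im)
            = fun E : ℝ => ∫ x : ℝ, η / ((x - E) ^ 2 + η ^ 2) ∂ρ :=
          funext fun E => im_stieltjes ρ (z := ⟨E, η⟩) hη
        rw [this]
        have hm : Measurable (Function.uncurry fun E x : ℝ => η / ((x - E) ^ 2 + η ^ 2)) := by
          fun_prop
        exact hm.stronglyMeasurable.integral_prod_right.aestronglyMeasurable
      · filter_upwards [hC, self_mem_nhdsWithin] with η hη hη0
        filter_upwards [ae_restrict_mem measurableSet_Ioo] with E hE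
        rw [Real.norm_of_nonneg (hpos hη0 E)]
        exact hη E (hsub hE)
      · filter_upwards [ae_restrict_mem measurableSet_Ioo] with E hE
        exact hlim E (hsub hE)
    rw [tendsto_nhds_unique h3 hI]
    exact ⟨h1, h2⟩
  have heq : ∀ {p q : ℝ}, Set.Ioo p q ⊆ Set.Ioo a b →
      Real.pi * ρ.real (Set.Ioo p q) = ∫ E in Set.Ioo p q, f E := by
    intro p q hsub
    rcases le_or_gt q p with hqp | hpq
    · simp [Set.Ioo_eq_empty (not_lt.2 hqp)]
    refine le_antisymm (hconv hpq.le hsub).1 ?_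
    have hC0 : 0 ≤ C := by
      have hmid : (p + q) / 2 ∈ Set.Ioo a b := hsub ⟨by linarith, by linarith⟩
      exact (hf0 _ hmid).trans (hfC _ hmid)
    -- shrink the interval by `ε` on either side
    have hε : ∀ ε, 0 < ε → ε < (q - p) / 2 →
        ∫ E in Set.Ioo p q, f E ≤ Real.pi * ρ.real (Set.Ioo p q) + 2 * C * ε := by
      intro ε h0 h1
      have hs1 : Set.Ioo (p + ε) (q - ε) ⊆ Set.Ioo p q :=
        Set.Ioo_subset_Ioo (by linarith) (by linarith)
      have hs2 : Set.Icc (p + ε) (q - ε) ⊆ Set.Ioo p q := fun x hx =>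
        ⟨by linarith [hx.1], by linarith [hx.2]⟩
      have e1 := (hconv (by linarith) (hs1.trans hsub)).2
      have e2 : ρ.real (Set.Icc (p + ε) (q - ε)) ≤ ρ.real (Set.Ioo p q) := measureReal_mono hs2
      have e3 : ∫ E in Set.Ioo p q, f E = (∫ E in Set.Ioo (p + ε) (q - ε), f E)
          + ∫ E in Set.Ioo p q \ Set.Ioo (p + ε) (q - ε), f E := by
        rw [setIntegral_sdiff measurableSet_Ioo (hfi hsub) hs1]
        ring
      have e4 : ∫ E in Set.Ioo p q \ Set.Ioo (p + ε) (q - ε), f E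
          ≤ ∫ E in Set.Ioo p q \ Set.Ioo (p + ε) (q - ε), C := by
        refine setIntegral_mono_on ((hfi hsub).mono_set Set.sdiff_subset) ?_
          (measurableSet_Ioo.diff measurableSet_Ioo) fun E hE => hfC E (hsub hE.1)
        exact integrableOn_const (ne_of_lt ((measure_mono Set.sdiff_subset).trans_lt (by simp)))
      have e5 : ∫ E in Set.Ioo p q \ Set.Ioo (p + ε) (q - ε), C = 2 * C * ε := by
        rw [setIntegral_const, smul_eq_mul, measureReal_sdiff hs1 measurableSet_Ioo (by simp),
          Real.volume_real_Ioo_of_le hpq.le, Real.volume_real_Ioo_of_le (by linarith)]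
        ring
      have e6 : Real.pi * ρ.real (Set.Icc (p + ε) (q - ε)) ≤ Real.pi * ρ.real (Set.Ioo p q) := by
        gcongr
      linarith
    have hlim0 : Tendsto (fun ε : ℝ => Real.pi * ρ.real (Set.Ioo p q) + 2 * C * ε) (𝓝[>] 0)
        (𝓝 (Real.pi * ρ.real (Set.Ioo p q))) := by
      have : Continuous fun ε : ℝ => Real.pi * ρ.real (Set.Ioo p q) + 2 * C * ε := by fun_prop
      simpa using (this.tendsto 0).mono_left nhdsWithin_le_nhds
    refine ge_of_tendsto hlim0 ?_
    filter_upwards [Ioo_mem_nhdsGT (show (0 : ℝ) < (q - p) / 2 by linarith)] with ε h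
    exact hε ε h.1 h.2
  refine Real.measure_ext_Ioo_rat fun p q => ?_
  rw [Measure.restrict_apply measurableSet_Ioo, withDensity_apply _ measurableSet_Ioo,
    Measure.restrict_restrict measurableSet_Ioo, Set.Ioo_inter_Ioo]
  set p' : ℝ := (p : ℝ) ⊔ a
  set q' : ℝ := (q : ℝ) ⊓ b
  have hsub : Set.Ioo p' q' ⊆ Set.Ioo a b := Set.Ioo_subset_Ioo le_sup_right inf_le_right
  rw [← ofReal_integral_eq_lintegral_ofReal ((hfi hsub).div_const _), integral_div, ← heq hsub,
    mul_div_cancel_left₀ _ hpi.ne', ofReal_measureReal]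
  filter_upwards [ae_restrict_mem measurableSet_Ioo] with E hE
  exact div_nonneg (hf0 E (hsub hE)) hpi.le

lemma measure_Ioo_eq_zero {a b : ℝ}
    (h : ∀ᶠ η in 𝓝[>] (0 : ℝ), ∀ E ∈ Set.Ioo a b, (stieltjes ρ ⟨E, η⟩).im ≤ 1)
    (hlim : ∀ E ∈ Set.Ioo a b,
      Tendsto (fun η : ℝ => (stieltjes ρ ⟨E, η⟩).im) (𝓝[>] 0) (𝓝 0)) :
    ρ (Set.Ioo a b) = 0 := by
  have h1 := restrict_Ioo_eq_withDensity ρ (f := fun _ => 0) measurable_const h hlim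
  simp only [zero_div, ENNReal.ofReal_zero] at h1
  rw [← Measure.restrict_eq_zero, h1]
  exact withDensity_zero

variable {ρ} {τ : ℝ}

/-- Left of the support the Stieltjes transform is continuous. -/
lemma continuousAt_stieltjes (hτ : ∀ᵐ x ∂ρ, τ ≤ x) {z : ℂ} (hz : z.re < τ) :
    ContinuousAt (stieltjes ρ) z := by
  obtain ⟨r, hr1, hr2⟩ := exists_between hz
  refine continuousAt_of_dominated (bound := fun _ => (τ - r)⁻¹)
    (Eventually.of_forall fun w => (by fun_prop : Measurable _).aestronglyMeasurable) ?_
    (integrable_const _) ?_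
  · filter_upwards [Complex.continuous_re.continuousAt.eventually_lt_const hr1] with w hw
    filter_upwards [hτ] with x hx
    rw [norm_inv]
    refine inv_anti₀ (by linarith) ?_
    have h := Complex.abs_re_le_norm ((x : ℂ) - w)
    simp only [Complex.sub_re, Complex.ofReal_re] at h
    linarith [le_abs_self (x - w.re)]
  · filter_upwards [hτ] with x hx
    refine ContinuousAt.inv₀ (by fun_prop) fun h => ?_
    have h1 := congrArg Complex.re h
    simp at h1
    linarith

variable (ρ) in
/-- The Stieltjes transform on the real axis left of the support. -/
def realStieltjes (x : ℝ) : ℝ := ∫ t : ℝ, (t - x)⁻¹ ∂ρ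

omit [IsProbabilityMeasure ρ] in
lemma stieltjes_ofReal (x : ℝ) : stieltjes ρ x = realStieltjes ρ x := by
  rw [stieltjes, realStieltjes, ← integral_complex_ofReal]
  simp

lemma integrable_real_kernel (hτ : ∀ᵐ x ∂ρ, τ ≤ x) {x : ℝ} (hx : x < τ) :
    Integrable (fun t : ℝ => (t - x)⁻¹) ρ := by
  refine Integrable.of_bound (by fun_prop : Measurable _).aestronglyMeasurable (τ - x)⁻¹ ?_
  filter_upwards [hτ] with t ht
  rw [norm_inv, Real.norm_of_nonneg (by linarith)]
  exact inv_anti₀ (by linarith) (by linarith)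

lemma realStieltjes_le (hτ : ∀ᵐ x ∂ρ, τ ≤ x) {x : ℝ} (hx : x < τ) :
    realStieltjes ρ x ≤ (τ - x)⁻¹ := by
  have h : ∫ t : ℝ, (t - x)⁻¹ ∂ρ ≤ ∫ _, (τ - x)⁻¹ ∂ρ := by
    refine integral_mono_ae (integrable_real_kernel hτ hx) (integrable_const _) ?_
    filter_upwards [hτ] with t ht
    exact inv_anti₀ (by linarith) (by linarith)
  simpa [realStieltjes] using h

lemma realStieltjes_pos (hτ : ∀ᵐ x ∂ρ, τ ≤ x) {x : ℝ} (hx : x < τ) :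
    0 < realStieltjes ρ x := by
  have hpos : ∀ᵐ t ∂ρ, 0 < (t - x)⁻¹ := by
    filter_upwards [hτ] with t ht
    exact inv_pos.2 (by linarith)
  refine (integral_pos_iff_support_of_nonneg_ae (hpos.mono fun t ht => ht.le)
    (integrable_real_kernel hτ hx)).2 ?_
  have : ρ (Function.support fun t : ℝ => (t - x)⁻¹) = ρ Set.univ :=
    measure_congr (by
      filter_upwards [hpos] with t ht
      exact eq_iff_iff.2 ⟨fun _ => trivial, fun _ => ht.ne'⟩)
  rw [this]
  simp

lemma monotoneOn_realStieltjes (hτ : ∀ᵐ x ∂ρ, τ ≤ x) :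
    MonotoneOn (realStieltjes ρ) (Set.Iio τ) := by
  intro x hx y hy hxy
  refine integral_mono_ae (integrable_real_kernel hτ hx) (integrable_real_kernel hτ hy) ?_
  filter_upwards [hτ] with t ht
  have : y < τ := hy
  exact inv_anti₀ (by linarith) (by linarith)

lemma continuousAt_realStieltjes (hτ : ∀ᵐ x ∂ρ, τ ≤ x) {x : ℝ} (hx : x < τ) :
    ContinuousAt (realStieltjes ρ) x := by
  have h : ContinuousAt (fun y : ℝ => (stieltjes ρ y).re) x :=
    Complex.continuous_re.continuousAt.comp
      (ContinuousAt.comp (g := stieltjes ρ) (continuousAt_stieltjes hτ (by simpa using hx))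
        Complex.continuous_ofReal.continuousAt)
  simpa [stieltjes_ofReal] using h

end

/-! ### Analytic continuation to the real axis -/

/-- Analytic local inverses. -/
lemma exists_analytic_localInverse {g : ℂ → ℂ} {w₀ g' : ℂ} (hg : AnalyticAt ℂ g w₀)
    (hg' : HasDerivAt g g' w₀) (h0 : g' ≠ 0) :
    ∃ Ψ : ℂ → ℂ, AnalyticAt ℂ Ψ (g w₀) ∧ Ψ (g w₀) = w₀ ∧ HasDerivAt Ψ g'⁻¹ (g w₀) ∧
      (∀ᶠ w in 𝓝 w₀, Ψ (g w) = w) ∧ ∀ᶠ y in 𝓝 (g w₀), g (Ψ y) = y := by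
  have hd : deriv g w₀ = g' := hg'.deriv
  subst hd
  refine ⟨hg.hasStrictDerivAt.localInverse _ _ _ h0, hg.analyticAt_localInverse h0, ?_, ?_, ?_, ?_⟩
  · exact (HasStrictDerivAt.eventually_left_inverse hg.hasStrictDerivAt h0).self_of_nhds
  · exact (hg.hasStrictDerivAt.to_localInverse h0).hasDerivAt
  · exact HasStrictDerivAt.eventually_left_inverse hg.hasStrictDerivAt h0
  · exact HasStrictDerivAt.eventually_right_inverse hg.hasStrictDerivAt h0

/-- A local inverse of a function that commutes with complex conjugation is real on the reals. -/
lemma eventually_im_localInverse_eq_zero {g Ψ : ℂ → ℂ} {w₀ y₀ : ℝ}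
    (hconj : ∀ w, g ((starRingEnd ℂ) w) = (starRingEnd ℂ) (g w))
    (hΨ : ContinuousAt Ψ y₀) (h0 : Ψ y₀ = w₀)
    (hl : ∀ᶠ w in 𝓝 (w₀ : ℂ), Ψ (g w) = w) (hr : ∀ᶠ y in 𝓝 (y₀ : ℂ), g (Ψ y) = y) :
    ∀ᶠ y : ℝ in 𝓝 y₀, (Ψ y).im = 0 := by
  have hc : Tendsto (fun y : ℝ => (starRingEnd ℂ) (Ψ y)) (𝓝 y₀) (𝓝 (w₀ : ℂ)) := by
    have h1 : Tendsto (fun y : ℝ => Ψ y) (𝓝 y₀) (𝓝 (w₀ : ℂ)) :=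
      h0 ▸ hΨ.tendsto.comp (Complex.continuous_ofReal.tendsto y₀)
    have h2 := (Complex.continuous_conj.tendsto (w₀ : ℂ)).comp h1
    rwa [Complex.conj_ofReal] at h2
  filter_upwards [hc.eventually hl, (Complex.continuous_ofReal.tendsto y₀).eventually hr]
    with y h1 h2
  rw [hconj, h2, Complex.conj_ofReal] at h1
  exact Complex.conj_eq_iff_im.1 h1.symm

/-- If `g ∘ m = s` near points `z` that accumulate at `τ` and at which `m` accumulates at the base
point of a local inverse `Ψ` of `g`, then `m = Ψ ∘ s` on a whole half disc around `τ`. -/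
lemma eventually_eq_localInverse_comp {m g s Ψ : ℂ → ℂ} {τ w₀ y₀ : ℂ}
    (hm : DifferentiableOn ℂ m upper) (hs : DifferentiableOn ℂ s upper)
    (hst : Tendsto s (𝓝[upper] τ) (𝓝 y₀)) (hΨ : AnalyticAt ℂ Ψ y₀)
    (hl : ∀ᶠ w in 𝓝 w₀, Ψ (g w) = w)
    (h : ∃ᶠ z in 𝓝[upper] τ ⊓ comap m (𝓝 w₀), ∀ᶠ y in 𝓝 z, g (m y) = s y) :
    ∀ᶠ z in 𝓝[upper] τ, m z = Ψ (s z) := by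
  obtain ⟨r, hr, hball⟩ := Metric.mem_nhdsWithin_iff.1 (hst.eventually hΨ.eventually_analyticAt)
  set D := Metric.ball τ r ∩ upper with hD
  have hDo : IsOpen D := Metric.isOpen_ball.inter isOpen_upper
  have hDc : IsPreconnected D := ((convex_ball τ r).inter convex_upper).isPreconnected
  have hDmem : D ∈ 𝓝[upper] τ :=
    inter_mem (mem_nhdsWithin_of_mem_nhds (Metric.ball_mem_nhds τ hr)) self_mem_nhdsWithin
  have hmA : AnalyticOnNhd ℂ m D := (hm.mono Set.inter_subset_right).analyticOnNhd hDo
  have hsA : AnalyticOnNhd ℂ s D := (hs.mono Set.inter_subset_right).analyticOnNhd hDo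
  have hΨA : AnalyticOnNhd ℂ (fun z => Ψ (s z)) D := fun z hz =>
    AnalyticAt.fun_comp (hball hz) (hsA z hz)
  have h1 : ∀ᶠ z in 𝓝[upper] τ ⊓ comap m (𝓝 w₀), z ∈ D := mem_inf_of_left hDmem
  have h2 : ∀ᶠ z in 𝓝[upper] τ ⊓ comap m (𝓝 w₀), ∀ᶠ w in 𝓝 (m z), Ψ (g w) = w :=
    mem_inf_of_right (preimage_mem_comap hl.eventually_nhds)
  obtain ⟨z, hz, hzD, hzl⟩ := (h.and_eventually (h1.and h2)).exists
  have heq : m =ᶠ[𝓝 z] fun z => Ψ (s z) := by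
    filter_upwards [hz, (hmA z hzD).continuousAt.eventually hzl] with y hy1 hy2
    rw [← hy1, hy2]
  filter_upwards [hDmem] with y hy
  exact hmA.eqOn_of_preconnected_of_eventuallyEq hΨA hDc hzD heq hy

/-- Half discs contain half rectangles. -/
lemma exists_rectangle {p : ℂ → Prop} {τ : ℝ} (h : ∀ᶠ z in 𝓝[upper] (τ : ℂ), p z) :
    ∃ δ > 0, ∀ E ∈ Set.Ioo (τ - δ) (τ + δ), ∀ η ∈ Set.Ioo 0 δ, p ⟨E, η⟩ := by
  obtain ⟨r, hr, hball⟩ := Metric.mem_nhdsWithin_iff.1 h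
  refine ⟨r / 2, by positivity, fun E hE η hη => hball ⟨?_, hη.1⟩⟩
  have h1 := Complex.norm_le_abs_re_add_abs_im ((⟨E, η⟩ : ℂ) - τ)
  simp only [Complex.sub_re, Complex.ofReal_re, Complex.sub_im, Complex.ofReal_im, sub_zero] at h1
  have h2 : |E - τ| < r / 2 := abs_lt.2 ⟨by linarith [hE.1], by linarith [hE.2]⟩
  have h3 : |η| < r / 2 := abs_lt.2 ⟨by linarith [hη.1], hη.2⟩
  rw [Metric.mem_ball, dist_eq_norm]
  linarith

/-! ### The bottom of the support -/

variable {ι κ : Type*} [Fintype ι] [Fintype κ]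

/-- An increasing branch of the inverse of `invMap` only reaches points at which `invMap` has a
nonnegative derivative. -/
lemma SpectralData.BeforePoles.slope_nonneg {d : SpectralData ι κ} {u : ℝ → ℝ} {x₀ w₀ : ℝ}
    (hb : d.BeforePoles w₀) (hu : Tendsto u (𝓝[<] x₀) (𝓝 w₀))
    (hle : ∀ᶠ x in 𝓝[<] x₀, u x ≤ w₀) (heq : ∀ᶠ x in 𝓝[<] x₀, d.invMap (u x) = x) :
    d.invMap w₀ = x₀ ∧ 0 ≤ d.slope w₀ := by
  have h0 : d.invMap w₀ = x₀ := by
    have h1 : Tendsto (fun x => d.invMap (u x)) (𝓝[<] x₀) (𝓝 (d.invMap w₀)) :=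
      hb.analyticAt_invMap.continuousAt.tendsto.comp
        ((Complex.continuous_ofReal.tendsto w₀).comp hu)
    have h2 : Tendsto (fun x : ℝ => (x : ℂ)) (𝓝[<] x₀) (𝓝 (x₀ : ℂ)) :=
      (Complex.continuous_ofReal.tendsto x₀).mono_left nhdsWithin_le_nhds
    exact tendsto_nhds_unique h1 (h2.congr' (heq.mono fun x hx => hx.symm))
  refine ⟨h0, ?_⟩
  have hd : HasDerivAt (fun w : ℝ => (d.invMap w).re) (d.slope w₀) w₀ := by
    simpa using hb.hasDerivAt_invMap.real_of_complex
  have hne : ∀ᶠ x in 𝓝[<] x₀, u x ≠ w₀ := by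
    filter_upwards [heq, self_mem_nhdsWithin] with x hx hlt huw
    rw [huw, h0] at hx
    have : x₀ = x := by exact_mod_cast hx
    exact (ne_of_lt hlt) this.symm
  have hs := (hasDerivAt_iff_tendsto_slope.1 hd).comp (tendsto_nhdsWithin_iff.2 ⟨hu, hne⟩)
  refine ge_of_tendsto hs ?_
  filter_upwards [hle, heq, self_mem_nhdsWithin] with x h1 h2 h3
  simp only [Function.comp_apply, slope_def_field, h2, h0, Complex.ofReal_re]
  exact div_nonneg_of_nonpos (by linarith [show x < x₀ from h3]) (by linarith)

/-- `m` solves the scalar equation in spectral coordinates. -/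
structure SpectralData.IsSolution (d : SpectralData ι κ) (m : ℂ → ℂ) : Prop where
  mapsTo : Set.MapsTo m upper upper
  analytic : DifferentiableOn ℂ m upper
  tendsto : Tendsto (fun z => z * m z) (Bornology.cobounded ℂ ⊓ 𝓟 upper) (𝓝 (-1))
  equation : ∀ z ∈ upper, d.invMap (m z) = z

namespace SpectralData.IsSolution

variable {d : SpectralData ι κ} {ρ : Measure ℝ} [IsProbabilityMeasure ρ]

/-- The support is bounded: `m(z)` tends to `0` at infinity, where `invMap` expands imaginary parts,
so that `Im m(z) ≤ Im z` for large `z`. -/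
lemma exists_support_subset (h : d.IsSolution (stieltjes ρ)) :
    ∃ R : ℝ, ∀ E ∈ ρ.support, |E| ≤ R := by
  have h0 : Tendsto (stieltjes ρ) (Bornology.cobounded ℂ ⊓ 𝓟 upper) (𝓝 0) := by
    have h1 : Tendsto (fun z : ℂ => z⁻¹) (Bornology.cobounded ℂ ⊓ 𝓟 upper) (𝓝 0) :=
      tendsto_inv₀_cobounded.mono_left inf_le_left
    have h2 := h1.mul h.tendsto
    rw [zero_mul] at h2
    refine h2.congr' ?_
    filter_upwards [mem_inf_of_right (mem_principal_self upper)] with z hz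
    have hz0 : z ≠ 0 := fun h => by simp [h, upper] at hz
    field_simp
  have h1 : ∀ᶠ z in Bornology.cobounded ℂ, z ∈ upper → (stieltjes ρ z).im ≤ z.im := by
    refine eventually_inf_principal.1 ?_
    filter_upwards [h0.eventually (eventually_im_le_im_invMap (d := d)),
      mem_inf_of_right (mem_principal_self upper)] with z hz hzu
    have := hz (h.mapsTo hzu)
    rwa [h.equation z hzu] at this
  obtain ⟨R, -, hR⟩ := (hasBasis_cobounded_norm (E := ℂ)).eventually_iff.1 h1
  refine ⟨R, fun E hE => ?_⟩
  by_contra hlt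
  push Not at hlt
  refine Measure.notMem_support_iff_exists.2
    ⟨Set.Ioo (E - (|E| - R)) (E + (|E| - R)), Ioo_mem_nhds (by linarith) (by linarith), ?_⟩ hE
  have hb : ∀ E' ∈ Set.Ioo (E - (|E| - R)) (E + (|E| - R)), ∀ η > 0,
      (stieltjes ρ ⟨E', η⟩).im ≤ η := fun E' hE' η hη => by
    refine hR ?_ hη
    have h3 : |E| - |E'| ≤ |E - E'| := abs_sub_abs_le_abs_sub E E'
    have h4 : |E - E'| < |E| - R := abs_lt.2 ⟨by linarith [hE'.2], by linarith [hE'.1]⟩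
    have h5 := Complex.abs_re_le_norm (⟨E', η⟩ : ℂ)
    simp only [Set.mem_ofPred_eq] at h5 ⊢
    linarith
  refine measure_Ioo_eq_zero ρ ?_ fun E' hE' => ?_
  · filter_upwards [Ioo_mem_nhdsGT one_pos] with η hη E' hE'
    exact (hb E' hE' η hη.1).trans hη.2.le
  · refine tendsto_of_tendsto_of_tendsto_of_le_of_le' tendsto_const_nhds
      (tendsto_nhdsWithin_of_tendsto_nhds tendsto_id) ?_ ?_
    · filter_upwards [self_mem_nhdsWithin] with η hη
      exact (mem_upper.1 (h.mapsTo (show (⟨E', η⟩ : ℂ) ∈ upper from hη))).le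
    · filter_upwards [self_mem_nhdsWithin] with η hη
      exact hb E' hE' η hη

variable {τ : ℝ}

/-- The scalar equation persists on the real axis left of the support. -/
lemma invMap_realStieltjes (h : d.IsSolution (stieltjes ρ)) (hτ : ∀ᵐ x ∂ρ, τ ≤ x) {x : ℝ}
    (hx : x < τ) (hb : d.BeforePoles (realStieltjes ρ x)) :
    d.invMap (realStieltjes ρ x) = x := by
  have hmk := (tendsto_mk_upper x).mono_right nhdsWithin_le_nhds
  have h1 : Tendsto (fun η : ℝ => stieltjes ρ ⟨x, η⟩) (𝓝[>] 0) (𝓝 (realStieltjes ρ x : ℂ)) := by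
    rw [← stieltjes_ofReal]
    exact (continuousAt_stieltjes hτ (z := x) (by simpa using hx)).tendsto.comp hmk
  have h2 := hb.analyticAt_invMap.continuousAt.tendsto.comp h1
  refine tendsto_nhds_unique (h2.congr' ?_) hmk
  filter_upwards [self_mem_nhdsWithin] with η hη
  exact h.equation _ hη

/-- The Stieltjes transform has a limit at the bottom of the support, and this limit lies before
the first pole. -/
lemma exists_limit (h : d.IsSolution (stieltjes ρ)) (hd : d.NonReducible)
    (hτ : ∀ᵐ x ∂ρ, τ ≤ x) :
    ∃ M, d.BeforePoles M ∧ Tendsto (realStieltjes ρ) (𝓝[<] τ) (𝓝 M) ∧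
      d.invMap M = τ ∧ 0 ≤ d.slope M := by
  obtain ⟨w₁, hb₁, hs₁⟩ := hd.exists_slope_neg
  have hmono := monotoneOn_realStieltjes hτ
  -- if the value `w₁` were exceeded, it would be attained
  have hle : ∀ x < τ, realStieltjes ρ x ≤ w₁ := by
    by_contra hcon
    push Not at hcon
    obtain ⟨x, hx, hlt⟩ := hcon
    set y := min x (τ - 1 / w₁) with hy
    have hyx : y ≤ x := min_le_left _ _
    have hw := hb₁.pos
    have hyτ : y < τ := hyx.trans_lt hx
    have hyw : realStieltjes ρ y ≤ w₁ := by
      refine (realStieltjes_le hτ hyτ).trans ?_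
      have h1 : y ≤ τ - 1 / w₁ := min_le_right _ _
      have h2 : (0 : ℝ) < 1 / w₁ := by positivity
      rw [inv_le_comm₀ (by linarith) hw, ← one_div]
      linarith
    have hcont : ContinuousOn (realStieltjes ρ) (Set.Icc y x) := fun t ht =>
      (continuousAt_realStieltjes hτ (ht.2.trans_lt hx)).continuousWithinAt
    obtain ⟨x₁, hx₁, hx₁w⟩ := intermediate_value_Icc hyx hcont ⟨hyw, hlt.le⟩
    have hx₁τ : x₁ < τ := hx₁.2.trans_lt hx
    have hle : ∀ t < x₁, realStieltjes ρ t ≤ w₁ := fun t ht =>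
      hx₁w ▸ hmono (ht.trans hx₁τ) hx₁τ ht.le
    have := (hb₁.slope_nonneg (u := realStieltjes ρ) (x₀ := x₁) ?_ ?_ ?_).2
    · linarith
    · rw [← hx₁w]
      exact (continuousAt_realStieltjes hτ hx₁τ).tendsto.mono_left nhdsWithin_le_nhds
    · filter_upwards [self_mem_nhdsWithin] with t ht
      exact hle t ht
    · filter_upwards [self_mem_nhdsWithin] with t ht
      exact h.invMap_realStieltjes hτ (lt_trans ht hx₁τ)
        (hb₁.mono (realStieltjes_pos hτ (lt_trans ht hx₁τ)) (hle t ht))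
  have hbdd : BddAbove (realStieltjes ρ '' Set.Iio τ) :=
    ⟨w₁, by rintro _ ⟨x, hx, rfl⟩; exact hle x hx⟩
  have hlim := hmono.tendsto_nhdsLT hbdd
  set M := sSup (realStieltjes ρ '' Set.Iio τ) with hM
  have hxM : ∀ x < τ, realStieltjes ρ x ≤ M := fun x hx => le_csSup hbdd ⟨x, hx, rfl⟩
  have hM1 : M ≤ w₁ := csSup_le ⟨_, τ - 1, by simp, rfl⟩
    (by rintro _ ⟨x, hx, rfl⟩; exact hle x hx)
  have hM0 : 0 < M := (realStieltjes_pos hτ (sub_one_lt τ)).trans_le (hxM _ (sub_one_lt τ))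
  have hbM := hb₁.mono hM0 hM1
  refine ⟨M, hbM, hlim, hbM.slope_nonneg hlim ?_ ?_⟩
  · filter_upwards [self_mem_nhdsWithin] with t ht
    exact hxM t ht
  · filter_upwards [self_mem_nhdsWithin] with t ht
    exact h.invMap_realStieltjes hτ ht (hb₁.mono (realStieltjes_pos hτ ht) (hle t ht))

/-- The limit `M` along the real axis is a cluster value of the Stieltjes transform as `z` tends to
`τ` in the upper half-plane. -/
lemma neBot_comap {M : ℝ} (hτ : ∀ᵐ x ∂ρ, τ ≤ x)
    (hM : Tendsto (realStieltjes ρ) (𝓝[<] τ) (𝓝 M)) :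
    (𝓝[upper] (τ : ℂ) ⊓ comap (stieltjes ρ) (𝓝 (M : ℂ))).NeBot := by
  rw [inf_comm, inf_neBot_iff_frequently_left]
  intro p hp
  rw [(nhds_basis_opens (M : ℂ)).comap _ |>.eventually_iff] at hp
  obtain ⟨U, ⟨hMU, hU⟩, hUp⟩ := hp
  suffices hfr : ∃ᶠ z in 𝓝[upper] (τ : ℂ), stieltjes ρ z ∈ U from
    hfr.mono fun z hz => hUp hz
  intro hcon
  have h1 : ∀ᶠ x : ℝ in 𝓝[<] τ, ∀ᶠ z in 𝓝[upper] (x : ℂ), stieltjes ρ z ∉ U := by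
    have h2 := (eventually_nhdsWithin_iff.1 hcon).eventually_nhds
    have h3 : Tendsto (fun x : ℝ => (x : ℂ)) (𝓝[<] τ) (𝓝 (τ : ℂ)) :=
      (Complex.continuous_ofReal.tendsto τ).mono_left nhdsWithin_le_nhds
    exact (h3.eventually h2).mono fun x hx => eventually_nhdsWithin_iff.2 hx
  have h2 : ∀ᶠ x : ℝ in 𝓝[<] τ, (realStieltjes ρ x : ℂ) ∈ U :=
    ((Complex.continuous_ofReal.tendsto M).comp hM).eventually (hU.mem_nhds hMU)
  obtain ⟨x, hx1, hx2, hx3⟩ := (h1.and (h2.and self_mem_nhdsWithin)).exists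
  rw [← stieltjes_ofReal] at hx2
  have h4 : ∀ᶠ z in 𝓝[upper] (x : ℂ), stieltjes ρ z ∈ U :=
    ((continuousAt_stieltjes hτ (z := x) (by simpa using hx3)).tendsto.mono_left
      nhdsWithin_le_nhds).eventually (hU.mem_nhds hx2)
  obtain ⟨η, h5, h6⟩ := ((tendsto_mk_upper x).eventually (hx1.and h4)).exists
  exact h5 h6

/-- At a regular point of `invMap` the measure has no mass. -/
lemma notMem_support {M : ℝ} (h : d.IsSolution (stieltjes ρ)) (hb : d.BeforePoles M)
    (hne : (𝓝[upper] (τ : ℂ) ⊓ comap (stieltjes ρ) (𝓝 (M : ℂ))).NeBot)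
    (hMτ : d.invMap M = τ) (hs : d.slope M ≠ 0) : τ ∉ ρ.support := by
  obtain ⟨Ψ, hΨ, hΨ0, -, hl, hr⟩ := exists_analytic_localInverse hb.analyticAt_invMap
    hb.hasDerivAt_invMap (by exact_mod_cast hs)
  rw [hMτ] at hΨ hΨ0 hr
  have heq : ∀ᶠ z in 𝓝[upper] (τ : ℂ), stieltjes ρ z = Ψ z := by
    refine eventually_eq_localInverse_comp (g := d.invMap) (s := fun z => z) h.analytic
      differentiableOn_id (tendsto_nhdsWithin_of_tendsto_nhds tendsto_id) hΨ hl ?_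
    refine Eventually.frequently ?_
    filter_upwards [mem_inf_of_left self_mem_nhdsWithin] with z hz
    filter_upwards [isOpen_upper.mem_nhds hz] with y hy
    exact h.equation y hy
  have hbd : ∀ᶠ z in 𝓝[upper] (τ : ℂ), (Ψ z).im ≤ 1 := by
    have : Tendsto (fun z => (Ψ z).im) (𝓝[upper] (τ : ℂ)) (𝓝 0) := by
      have h1 := (Complex.continuous_im.tendsto _).comp hΨ.continuousAt.tendsto
      rw [hΨ0, Complex.ofReal_im] at h1
      exact h1.mono_left nhdsWithin_le_nhds
    exact (this.eventually_lt_const one_pos).mono fun z hz => hz.le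
  obtain ⟨δ, hδ, hrect⟩ := exists_rectangle (heq.and hbd)
  have hreal : ∀ᶠ y : ℝ in 𝓝 τ, (Ψ y).im = 0 ∧ ContinuousAt Ψ y :=
    (eventually_im_localInverse_eq_zero invMap_conj hΨ.continuousAt hΨ0 hl hr).and
      ((Complex.continuous_ofReal.tendsto τ).eventually
        (hΨ.eventually_analyticAt.mono fun y hy => hy.continuousAt))
  obtain ⟨δ', hδ', hball⟩ := Metric.eventually_nhds_iff.1 hreal
  refine Measure.notMem_support_iff_exists.2
    ⟨Set.Ioo (τ - min δ δ') (τ + min δ δ'),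
      Ioo_mem_nhds (by simp [hδ, hδ']) (by simp [hδ, hδ']), ?_⟩
  have hsub : Set.Ioo (τ - min δ δ') (τ + min δ δ') ⊆ Set.Ioo (τ - δ) (τ + δ) :=
    Set.Ioo_subset_Ioo (by linarith [min_le_left δ δ']) (by linarith [min_le_left δ δ'])
  refine measure_Ioo_eq_zero ρ ?_ fun E hE => ?_
  · filter_upwards [Ioo_mem_nhdsGT hδ] with η hη E hE
    have := hrect E (hsub hE) η hη
    rw [this.1]
    exact this.2
  · have hE' : dist E τ < δ' := by
      rw [Real.dist_eq, abs_lt]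
      constructor <;> linarith [hE.1, hE.2, min_le_right δ δ']
    obtain ⟨h1, h2⟩ := hball hE'
    have h3 := (Complex.continuous_im.tendsto _).comp
      (h2.tendsto.comp ((tendsto_mk_upper E).mono_right nhdsWithin_le_nhds))
    rw [h1] at h3
    refine h3.congr' ?_
    filter_upwards [Ioo_mem_nhdsGT hδ] with η hη
    simp [(hrect E (hsub hE) η hη).1]

end SpectralData.IsSolution

/-! ### Square root behaviour at a non-degenerate critical point -/

/-- The branch of `√(τ - z)`, up to sign, that is continuous on the closed upper half-plane. -/
def sqrtBranch (τ : ℝ) (z : ℂ) : ℂ := Complex.I * (z - τ) ^ (1 / 2 : ℂ)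

lemma cpow_half_sq (z : ℂ) : (z ^ (1 / 2 : ℂ)) ^ 2 = z := by
  rw [← Complex.cpow_nat_mul]
  norm_num

lemma sqrtBranch_sq (τ : ℝ) (z : ℂ) : sqrtBranch τ z ^ 2 = τ - z := by
  rw [sqrtBranch, mul_pow, cpow_half_sq, Complex.I_sq]
  ring

lemma differentiableOn_sqrtBranch (τ : ℝ) : DifferentiableOn ℂ (sqrtBranch τ) upper := by
  intro z hz
  refine DifferentiableAt.differentiableWithinAt ?_
  have : z - τ ∈ Complex.slitPlane := Or.inr (by simpa using (mem_upper.1 hz).ne')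
  unfold sqrtBranch
  exact ((differentiableAt_id.sub_const _).cpow_const this).const_mul _

lemma sqrtBranch_ofReal {τ E : ℝ} (h : τ ≤ E) :
    sqrtBranch τ E = Complex.I * (Real.sqrt (E - τ) : ℂ) := by
  rw [sqrtBranch, Real.sqrt_eq_rpow, Complex.ofReal_cpow (by linarith)]
  push_cast
  rfl

lemma continuousAt_sqrtBranch {τ E : ℝ} (h : τ ≤ E) : ContinuousAt (sqrtBranch τ) E := by
  unfold sqrtBranch
  rcases h.eq_or_lt with rfl | h
  · refine continuousAt_const.mul ?_
    have h1 : ContinuousAt (fun z : ℂ => z ^ (1 / 2 : ℂ)) ((τ : ℂ) - τ) := by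
      rw [sub_self]
      exact Complex.continuousAt_cpow_const_of_re_pos (Or.inl le_rfl) (by norm_num)
    exact ContinuousAt.comp (f := fun z : ℂ => z - τ) h1 (by fun_prop)
  · refine continuousAt_const.mul ?_
    refine ContinuousAt.cpow (by fun_prop) continuousAt_const (Or.inl ?_)
    simpa using h

/-- An analytic square root of `τ - invMap` near a critical point. -/
lemma SpectralData.BeforePoles.exists_sqrt {ι κ : Type*} [Fintype ι] [Fintype κ]
    {d : SpectralData ι κ} {M τ k : ℝ} (hb : d.BeforePoles M) (hMτ : d.invMap M = τ)
    (hs : d.slope M = 0) (hk : 0 < k) (hQ : d.secondQuotient M M = -(k : ℂ)) :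
    ∃ g : ℂ → ℂ, AnalyticAt ℂ g M ∧ g M = 0 ∧ HasDerivAt g (Real.sqrt k : ℂ) M ∧
      ∀ᶠ w in 𝓝 (M : ℂ), g w ^ 2 = τ - d.invMap w := by
  set r : ℂ → ℂ := fun w => (-d.secondQuotient M w) ^ (1 / 2 : ℂ) with hr
  have hra : AnalyticAt ℂ r M := by
    refine hb.analyticAt_secondQuotient.neg.cpow analyticAt_const (Or.inl ?_)
    simpa [hQ] using hk
  have hrM : r M = (Real.sqrt k : ℂ) := by
    simp only [hr, hQ, neg_neg]
    rw [Real.sqrt_eq_rpow, Complex.ofReal_cpow hk.le]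
    push_cast
    rfl
  refine ⟨fun w => (w - M) * r w, by fun_prop, by simp, ?_, ?_⟩
  · have h1 : HasDerivAt (fun w : ℂ => w - M) 1 (M : ℂ) := (hasDerivAt_id _).sub_const _
    have h2 := h1.mul hra.differentiableAt.hasDerivAt
    rw [sub_self, zero_mul, add_zero, one_mul, hrM] at h2
    exact h2
  · filter_upwards [hb.eventually_ne] with w hw
    have h1 := invMap_sub_invMap hb hw.1 hw.2.1 hw.2.2
    rw [hs, hMτ] at h1
    rw [mul_pow, hr]
    simp only [cpow_half_sq]
    push_cast at h1
    linear_combination h1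

/-- A measure whose Stieltjes transform is an analytic function of `√(τ - z)` with a non-zero
first order term has a regular edge at the bottom `τ` of its support. -/
lemma hasRegularEdge_of_sqrt_expansion {ρ : Measure ℝ} [IsProbabilityMeasure ρ]
    {τ : ℝ} {Φ : ℂ → ℂ} {M q : ℝ}
    (hm : Set.MapsTo (stieltjes ρ) upper upper)
    (hsupp : ρ.support ⊆ Set.Ici τ) (hτ : ∀ᵐ x ∂ρ, τ ≤ x)
    (hΦ : AnalyticAt ℂ Φ 0) (hΦ0 : Φ 0 = M) (hq : q ≠ 0) (hΦ' : HasDerivAt Φ (q : ℂ) 0)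
    (heq : ∀ᶠ z in 𝓝[upper] (τ : ℂ), stieltjes ρ z = Φ (sqrtBranch τ z)) :
    HasRegularEdge ρ τ := by
  have hpi := Real.pi_pos
  have hst : Tendsto (sqrtBranch τ) (𝓝 (τ : ℂ)) (𝓝 0) := by
    have h1 := (continuousAt_sqrtBranch (le_refl τ)).tendsto
    rw [sqrtBranch_ofReal le_rfl] at h1
    simpa using h1
  have hbd : ∀ᶠ z in 𝓝[upper] (τ : ℂ), (Φ (sqrtBranch τ z)).im ≤ 1 := by
    have h1 := (Complex.continuous_im.tendsto _).comp (hΦ.continuousAt.tendsto.comp hst)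
    rw [hΦ0, Complex.ofReal_im] at h1
    exact ((h1.mono_left nhdsWithin_le_nhds).eventually_lt_const one_pos).mono fun z hz => hz.le
  obtain ⟨δ₁, hδ₁, hrect⟩ := exists_rectangle (heq.and hbd)
  have hcont : ∀ᶠ E : ℝ in 𝓝 τ, ContinuousAt Φ (sqrtBranch τ E) :=
    (Complex.continuous_ofReal.tendsto τ).eventually
      (hst.eventually (hΦ.eventually_analyticAt.mono fun y hy => hy.continuousAt))
  obtain ⟨δ₂, hδ₂, hball⟩ := Metric.eventually_nhds_iff.1 hcont
  set δ := min δ₁ δ₂ with hδ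
  have hδ0 : 0 < δ := lt_min hδ₁ hδ₂
  set F : ℝ → ℝ := fun E => |(Φ (sqrtBranch τ E)).im| with hF
  have hFc : ∀ E ∈ Set.Ico τ (τ + δ), ContinuousAt (fun E : ℝ => Φ (sqrtBranch τ E)) E := by
    intro E hE
    have h1 : ContinuousAt Φ (sqrtBranch τ E) := hball (by
      rw [Real.dist_eq, abs_of_nonneg (by linarith [hE.1])]
      linarith [hE.2, min_le_right δ₁ δ₂])
    have h2 : ContinuousAt (fun E : ℝ => sqrtBranch τ E) E :=
      ContinuousAt.comp' (continuousAt_sqrtBranch hE.1) Complex.continuous_ofReal.continuousAt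
    exact ContinuousAt.comp' h1 h2
  classical
  set f : ℝ → ℝ := (Set.Ioo τ (τ + δ)).piecewise F 0 with hf
  have hfm : Measurable f := by
    refine ContinuousOn.measurable_piecewise (fun E hE => ?_) continuousOn_const measurableSet_Ioo
    exact (Complex.continuous_im.continuousAt.comp'
      (hFc E ⟨hE.1.le, hE.2⟩)).abs.continuousWithinAt
  have hf0 : ∀ x, 0 ≤ f x := fun x => by
    simp only [hf, Set.piecewise]
    split_ifs
    · exact abs_nonneg _
    · exact le_rfl
  have hsub : Set.Ioo (τ - δ) (τ + δ) ⊆ Set.Ioo (τ - δ₁) (τ + δ₁) :=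
    Set.Ioo_subset_Ioo (by linarith [min_le_left δ₁ δ₂]) (by linarith [min_le_left δ₁ δ₂])
  refine ⟨δ, fun E => f E / Real.pi, hδ0, hfm.div_const _, fun x => div_nonneg (hf0 x) hpi.le,
    ?_, |q| / Real.pi, div_ne_zero (abs_ne_zero.2 hq) hpi.ne', ?_⟩
  · refine restrict_Ioo_eq_withDensity ρ (C := 1) hfm ?_ fun E hE => ?_
    · filter_upwards [Ioo_mem_nhdsGT hδ₁] with η hη E hE
      have := hrect E (hsub hE) η hη
      rw [this.1]
      exact this.2
    · have hmk := (tendsto_mk_upper E).mono_right nhdsWithin_le_nhds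
      rcases lt_or_ge E τ with hlt | hge
      · have h1 : f E = 0 := by simp [hf, hlt.le]
        have h2 := (Complex.continuous_im.tendsto _).comp
          ((continuousAt_stieltjes hτ (z := E) (by simpa using hlt)).tendsto.comp hmk)
        rw [stieltjes_ofReal, Complex.ofReal_im] at h2
        rw [h1]
        exact h2
      · have hcE : ContinuousAt Φ (sqrtBranch τ E) := hball (by
          rw [Real.dist_eq, abs_of_nonneg (by linarith)]
          linarith [hE.2, min_le_right δ₁ δ₂])
        have h2 := (Complex.continuous_im.tendsto _).comp
          (hcE.tendsto.comp ((continuousAt_sqrtBranch hge).tendsto.comp hmk))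
        have h3 : Tendsto (fun η : ℝ => (stieltjes ρ ⟨E, η⟩).im) (𝓝[>] 0)
            (𝓝 (Φ (sqrtBranch τ E)).im) := by
          refine h2.congr' ?_
          filter_upwards [Ioo_mem_nhdsGT hδ₁] with η hη
          simp [(hrect E (hsub hE) η hη).1]
        have h4 : 0 ≤ (Φ (sqrtBranch τ E)).im := by
          refine ge_of_tendsto h3 ?_
          filter_upwards [self_mem_nhdsWithin] with η hη
          exact (mem_upper.1 (hm (show (⟨E, η⟩ : ℂ) ∈ upper from hη))).le
        have h5 : f E = (Φ (sqrtBranch τ E)).im := by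
          rcases hge.eq_or_lt with rfl | hgt
          · simp [hf, sqrtBranch_ofReal, hΦ0]
          · simp [hf, hgt, hE.2, hF, abs_of_nonneg h4]
        rwa [h5]
  · have hle : 𝓝[ρ.support \ {τ}] τ ≤ 𝓝[>] τ :=
      nhdsWithin_mono _ fun x hx => lt_of_le_of_ne (hsupp hx.1) fun h => hx.2 h.symm
    refine Tendsto.mono_left ?_ hle
    have h1 : Tendsto (fun t : ℝ => |(Φ (Complex.I * t)).im| / t) (𝓝[>] 0) (𝓝 |q|) := by
      have h2 : HasDerivAt (fun y : ℂ => Φ (Complex.I * y)) ((q : ℂ) * Complex.I) ((0 : ℝ) : ℂ) := by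
        have h3 : HasDerivAt Φ (q : ℂ) (Complex.I * ((0 : ℝ) : ℂ)) := by simpa using hΦ'
        exact h3.comp _ (by simpa using (hasDerivAt_id ((0 : ℝ) : ℂ)).const_mul Complex.I)
      have h4 := hasDerivAt_iff_tendsto_slope_zero.1 h2.comp_ofReal
      have h5 := ((Complex.continuous_im.tendsto _).comp h4).abs
      have h6 : ((q : ℂ) * Complex.I).im = q := by simp
      rw [h6] at h5
      refine (h5.mono_left (nhdsGT_le_nhdsNE 0)).congr' ?_
      filter_upwards [self_mem_nhdsWithin] with t ht
      have ht0 : (0 : ℝ) < t := ht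
      simp [hΦ0, abs_mul, abs_of_pos ht0]
      ring
    have h2 : Tendsto (fun E : ℝ => Real.sqrt (E - τ)) (𝓝[>] τ) (𝓝[>] 0) := by
      refine tendsto_nhdsWithin_iff.2 ⟨?_, ?_⟩
      · have : Continuous fun E : ℝ => Real.sqrt (E - τ) := by fun_prop
        simpa using (this.tendsto τ).mono_left nhdsWithin_le_nhds
      · filter_upwards [self_mem_nhdsWithin] with E hE
        exact Real.sqrt_pos.2 (sub_pos.2 hE)
    refine ((h1.comp h2).div_const Real.pi).congr' ?_
    filter_upwards [Ioo_mem_nhdsGT (show τ < τ + δ by linarith)] with E hE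
    have h3 : |τ - E| = E - τ := by rw [abs_sub_comm, abs_of_pos (by linarith [hE.1])]
    simp only [Function.comp_apply, hf, Set.piecewise, if_pos hE, hF, h3,
      sqrtBranch_ofReal hE.1.le]
    ring

namespace SpectralData.IsSolution

variable {ι κ : Type*} [Fintype ι] [Fintype κ] {d : SpectralData ι κ} {ρ : Measure ℝ}
  [IsProbabilityMeasure ρ] {τ : ℝ}

omit [IsProbabilityMeasure ρ] in
/-- At a non-degenerate critical point of `invMap` the Stieltjes transform is an analytic function
of `√(τ - z)`. Either sign of the square root is absorbed into the function `Φ`. -/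
lemma exists_sqrt_expansion {M k : ℝ} (h : d.IsSolution (stieltjes ρ)) (hb : d.BeforePoles M)
    (hne : (𝓝[upper] (τ : ℂ) ⊓ comap (stieltjes ρ) (𝓝 (M : ℂ))).NeBot)
    (hMτ : d.invMap M = τ) (hs : d.slope M = 0) (hk : 0 < k)
    (hQ : d.secondQuotient M M = -(k : ℂ)) :
    ∃ Φ : ℂ → ℂ, AnalyticAt ℂ Φ 0 ∧ Φ 0 = M ∧
      (∃ q : ℝ, q ≠ 0 ∧ HasDerivAt Φ (q : ℂ) 0) ∧
      ∀ᶠ z in 𝓝[upper] (τ : ℂ), stieltjes ρ z = Φ (sqrtBranch τ z) := by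
  obtain ⟨g, hg, hg0, hg', hgsq⟩ := hb.exists_sqrt hMτ hs hk hQ
  have hk' : Real.sqrt k ≠ 0 := (Real.sqrt_pos.2 hk).ne'
  obtain ⟨Ψ, hΨ, hΨ0, hΨ', hl, -⟩ := exists_analytic_localInverse hg hg' (by exact_mod_cast hk')
  rw [hg0] at hΨ hΨ0 hΨ'
  have hsm := differentiableOn_sqrtBranch τ
  have hst : Tendsto (sqrtBranch τ) (𝓝[upper] (τ : ℂ)) (𝓝 0) := by
    have h1 := (continuousAt_sqrtBranch (le_refl τ)).tendsto
    rw [sqrtBranch_ofReal le_rfl] at h1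
    simp only [sub_self, Real.sqrt_zero, Complex.ofReal_zero, mul_zero] at h1
    exact h1.mono_left nhdsWithin_le_nhds
  -- the sign is locally constant
  have hsign : ∀ᶠ z in 𝓝[upper] (τ : ℂ) ⊓ comap (stieltjes ρ) (𝓝 (M : ℂ)),
      (∀ᶠ y in 𝓝 z, g (stieltjes ρ y) = sqrtBranch τ y) ∨
        ∀ᶠ y in 𝓝 z, g (stieltjes ρ y) = -sqrtBranch τ y := by
    have h1 : ∀ᶠ z in 𝓝[upper] (τ : ℂ) ⊓ comap (stieltjes ρ) (𝓝 (M : ℂ)),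
        AnalyticAt ℂ g (stieltjes ρ z) ∧
          ∀ᶠ w in 𝓝 (stieltjes ρ z), g w ^ 2 = τ - d.invMap w :=
      mem_inf_of_right (preimage_mem_comap (hg.eventually_analyticAt.and hgsq.eventually_nhds))
    filter_upwards [mem_inf_of_left self_mem_nhdsWithin, h1] with z hz hz1
    have hzn := isOpen_upper.mem_nhds hz
    have hmc : ContinuousAt (stieltjes ρ) z := (h.analytic.differentiableAt hzn).continuousAt
    have hsc : ContinuousAt (sqrtBranch τ) z := (hsm.differentiableAt hzn).continuousAt
    have hgc : ContinuousAt (fun y => g (stieltjes ρ y)) z := hz1.1.continuousAt.comp' hmc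
    have hsq : ∀ᶠ y in 𝓝 z, g (stieltjes ρ y) ^ 2 = sqrtBranch τ y ^ 2 := by
      filter_upwards [hmc.eventually hz1.2, hzn] with y hy hyu
      rw [hy, sqrtBranch_sq, h.equation y hyu]
    have hs0 : sqrtBranch τ z ≠ 0 := fun h0 => by
      have h2 := sqrtBranch_sq τ z
      rw [h0, zero_pow two_ne_zero] at h2
      have h3 := congrArg Complex.im h2
      simp only [Complex.zero_im, Complex.sub_im, Complex.ofReal_im, zero_sub] at h3
      have := mem_upper.1 hz
      linarith
    rcases sq_eq_sq_iff_eq_or_eq_neg.1 hsq.self_of_nhds with h2 | h2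
    · left
      have h3 : g (stieltjes ρ z) + sqrtBranch τ z ≠ 0 := by
        rw [h2, ← two_mul]
        exact mul_ne_zero two_ne_zero hs0
      filter_upwards [hsq, (hgc.add hsc).eventually_ne h3] with y hy1 hy2
      exact (sq_eq_sq_iff_eq_or_eq_neg.1 hy1).resolve_right fun h4 => hy2 (by simp [h4])
    · right
      have h3 : g (stieltjes ρ z) - sqrtBranch τ z ≠ 0 := by
        rw [h2, ← neg_add', neg_ne_zero, ← two_mul]
        exact mul_ne_zero two_ne_zero hs0
      filter_upwards [hsq, (hgc.sub hsc).eventually_ne h3] with y hy1 hy2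
      exact (sq_eq_sq_iff_eq_or_eq_neg.1 hy1).resolve_left fun h4 => hy2 (by simp [h4])
  rcases frequently_or_distrib.1 hsign.frequently with hf | hf
  · refine ⟨Ψ, hΨ, hΨ0, ⟨(Real.sqrt k)⁻¹, inv_ne_zero hk', by push_cast; exact hΨ'⟩, ?_⟩
    exact eventually_eq_localInverse_comp h.analytic hsm hst hΨ hl hf
  · refine ⟨fun y => Ψ (-y), ?_, by simpa using hΨ0,
      ⟨-(Real.sqrt k)⁻¹, neg_ne_zero.2 (inv_ne_zero hk'), ?_⟩, ?_⟩
    · exact AnalyticAt.fun_comp (by simpa using hΨ) (by fun_prop)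
    · have h1 : HasDerivAt Ψ (Real.sqrt k : ℂ)⁻¹ (-0) := by simpa using hΨ'
      have h2 := h1.comp (0 : ℂ) (hasDerivAt_neg (0 : ℂ))
      simpa [Function.comp_def] using h2
    · refine eventually_eq_localInverse_comp (s := fun z => -sqrtBranch τ z) h.analytic hsm.neg ?_
        hΨ hl hf
      simpa using hst.neg

/-- The bottom of the support is a regular edge. -/
theorem exists_isLeast (h : d.IsSolution (stieltjes ρ)) (hd : d.NonReducible) :
    ∃ τ, IsLeast ρ.support τ ∧ HasRegularEdge ρ τ := by
  obtain ⟨R, hR⟩ := h.exists_support_subset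
  have hbdd : BddBelow ρ.support := ⟨-R, fun x hx => (abs_le.1 (hR x hx)).1⟩
  have hmem : ρ.support ∈ ae ρ := Measure.support_mem_ae
  have hnonempty : ρ.support.Nonempty := by
    rw [Set.nonempty_iff_ne_empty]
    intro h0
    rw [h0] at hmem
    exact (ae_neBot.2 (IsProbabilityMeasure.ne_zero ρ)).ne (empty_mem_iff_bot.1 hmem)
  have hτ := Measure.isClosed_support.csInf_mem hnonempty hbdd
  set τ := sInf ρ.support
  have hle : ρ.support ⊆ Set.Ici τ := fun x hx => csInf_le hbdd hx
  have hae : ∀ᵐ x ∂ρ, τ ≤ x := mem_of_superset hmem hle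
  refine ⟨τ, ⟨hτ, hle⟩, ?_⟩
  obtain ⟨M, hb, hlim, hMτ, hs⟩ := h.exists_limit hd hae
  have hne := neBot_comap hae hlim
  have hs0 : d.slope M = 0 := by
    by_contra hs0
    exact h.notMem_support hb hne hMτ hs0 hτ
  obtain ⟨k, hk, hQ⟩ := hd.secondQuotient_neg hb hs0
  obtain ⟨Φ, hΦ, hΦ0, ⟨q, hq, hΦ'⟩, heq⟩ := h.exists_sqrt_expansion hb hne hMτ hs0 hk hQ
  exact hasRegularEdge_of_sqrt_expansion h.mapsTo hle hae hΦ hΦ0 hq hΦ' heq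

end SpectralData.IsSolution

/-! ### Reflection -/

lemma stieltjes_map_neg (ρ : Measure ℝ) (z : ℂ) :
    stieltjes (ρ.map Neg.neg) z = -(starRingEnd ℂ) (stieltjes ρ (-(starRingEnd ℂ) z)) := by
  rw [stieltjes, integral_map measurable_neg.aemeasurable
    (by fun_prop : Measurable _).aestronglyMeasurable, stieltjes, ← integral_conj, ← integral_neg]
  refine integral_congr_ae (ae_of_all _ fun x => ?_)
  simp only [map_inv₀, map_sub, map_neg, Complex.conj_conj, Complex.conj_ofReal, ← inv_neg]
  congr 1
  push_cast
  ring

lemma neg_conj_mem_upper {z : ℂ} (hz : z ∈ upper) : -(starRingEnd ℂ) z ∈ upper := by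
  simpa [upper] using hz

/-- Reflecting the measure corresponds to changing the sign of the polynomial. -/
lemma SpectralData.IsSolution.reflect {ι κ : Type*} [Fintype ι] [Fintype κ]
    {d : SpectralData ι κ} {ρ : Measure ℝ} (h : d.IsSolution (stieltjes ρ)) :
    d.neg.IsSolution (stieltjes (ρ.map Neg.neg)) where
  mapsTo z hz := by
    rw [stieltjes_map_neg]
    exact neg_conj_mem_upper (h.mapsTo (neg_conj_mem_upper hz))
  analytic z hz := by
    have h1 : DifferentiableAt ℂ (fun z => stieltjes ρ (-z)) ((starRingEnd ℂ) z) := by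
      have := h.analytic.differentiableAt (isOpen_upper.mem_nhds (neg_conj_mem_upper hz))
      exact DifferentiableAt.fun_comp' _ this (by fun_prop)
    have h2 : stieltjes (ρ.map Neg.neg)
        = fun z => -((starRingEnd ℂ) ∘ (fun z => stieltjes ρ (-z)) ∘ (starRingEnd ℂ)) z :=
      funext fun z => stieltjes_map_neg ρ z
    rw [h2]
    have h3 := h1.conj_conj
    rw [Complex.conj_conj] at h3
    exact h3.neg.differentiableWithinAt
  tendsto := by
    have h1 : Tendsto (fun z : ℂ => -(starRingEnd ℂ) z) (Bornology.cobounded ℂ ⊓ 𝓟 upper)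
        (Bornology.cobounded ℂ ⊓ 𝓟 upper) := by
      refine Tendsto.inf ?_ (tendsto_principal_principal.2 fun z hz => neg_conj_mem_upper hz)
      rw [← tendsto_norm_atTop_iff_cobounded]
      simpa using tendsto_norm_cobounded_atTop (E := ℂ)
    have h2 := (Complex.continuous_conj.tendsto _).comp (h.tendsto.comp h1)
    have h3 : (starRingEnd ℂ) (-1) = -1 := by simp
    rw [h3] at h2
    refine h2.congr fun z => ?_
    rw [stieltjes_map_neg]
    simp
  equation z hz := by
    rw [stieltjes_map_neg, invMap_neg, neg_neg, invMap_conj,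
      h.equation _ (neg_conj_mem_upper hz)]
    simp

lemma mem_support_map_neg {ρ : Measure ℝ} {x : ℝ} :
    x ∈ (ρ.map Neg.neg).support ↔ -x ∈ ρ.support := by
  have key : ∀ {ρ : Measure ℝ} {x : ℝ}, x ∈ (ρ.map Neg.neg).support → -x ∈ ρ.support := by
    intro ρ x hx
    rw [Measure.mem_support_iff_forall] at hx ⊢
    intro U hU
    have h1 := hx (Neg.neg ⁻¹' U) (continuous_neg.continuousAt hU)
    have h2 := (MeasurableEquiv.neg ℝ).map_apply (μ := ρ) (Neg.neg ⁻¹' U)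
    change ρ.map Neg.neg (Neg.neg ⁻¹' U) = ρ (Neg.neg ⁻¹' (Neg.neg ⁻¹' U)) at h2
    rw [h2] at h1
    simpa [← Set.preimage_comp] using h1
  refine ⟨key, fun hx => ?_⟩
  have h1 : (ρ.map Neg.neg).map Neg.neg = ρ := by
    rw [Measure.map_map measurable_neg measurable_neg]
    simp
  rw [← h1] at hx
  simpa using key hx

lemma HasRegularEdge.reflect {ρ : Measure ℝ} {τ : ℝ} (h : HasRegularEdge (ρ.map Neg.neg) τ) :
    HasRegularEdge ρ (-τ) := by
  obtain ⟨ε, f, hε, hf, hf0, heq, L, hL, hlim⟩ := h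
  refine ⟨ε, fun x => f (-x), hε, hf.comp measurable_neg, fun x => hf0 _, ?_, L, hL, ?_⟩
  · have hI : Neg.neg ⁻¹' Set.Ioo (-τ - ε) (-τ + ε) = Set.Ioo (τ - ε) (τ + ε) := by
      ext x
      simp only [Set.mem_preimage, Set.mem_Ioo]
      constructor <;> rintro ⟨h1, h2⟩ <;> constructor <;> linarith
    ext s hs
    have h1 := congrArg (fun μ : Measure ℝ => μ (Neg.neg ⁻¹' s)) heq
    have hs' : MeasurableSet (Neg.neg ⁻¹' s : Set ℝ) := measurable_neg hs
    simp only [Measure.restrict_apply hs', withDensity_apply _ hs',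
      Measure.restrict_restrict hs'] at h1
    rw [← hI, ← Set.preimage_inter, Measure.map_apply measurable_neg
      (measurable_neg (hs.inter measurableSet_Ioo)), ← Set.preimage_comp] at h1
    rw [Measure.restrict_apply hs, withDensity_apply _ hs, Measure.restrict_restrict hs]
    have h2 := (Measure.measurePreserving_neg (volume : Measure ℝ)).setLIntegral_comp_preimage_emb
      (MeasurableEquiv.neg ℝ).measurableEmbedding (fun x => ENNReal.ofReal (f (-x)))
      (s ∩ Set.Ioo (-τ - ε) (-τ + ε))
    simp only [neg_neg] at h2
    rw [← h2, ← h1]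
    simp
  · have h1 : Tendsto (fun E : ℝ => -E) (𝓝[ρ.support \ {-τ}] (-τ))
        (𝓝[(ρ.map Neg.neg).support \ {τ}] τ) := by
      refine tendsto_nhdsWithin_iff.2 ⟨?_, ?_⟩
      · have := (continuous_neg.tendsto (-τ)).mono_left
          (nhdsWithin_le_nhds (s := ρ.support \ {-τ}))
        rwa [neg_neg] at this
      · filter_upwards [self_mem_nhdsWithin] with E hE
        refine ⟨mem_support_map_neg.2 (by simpa using hE.1), fun h => hE.2 ?_⟩
        simp only [Set.mem_singleton_iff] at h ⊢
        linarith
    refine (hlim.comp h1).congr fun E => ?_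
    simp only [Function.comp_apply]
    congr 2
    rw [← abs_neg]
    congr 1
    ring

/-! ### Diagonalization of the scalar equation -/

variable {l : ℕ}

/-- The matrix with eigenvalues `f` and the columns of `U` as eigenvectors. -/
def conjDiag (U : Matrix.unitaryGroup (Fin l) ℂ) (f : Fin l → ℂ) : Matrix (Fin l) (Fin l) ℂ :=
  U * Matrix.diagonal f * star (U : Matrix (Fin l) (Fin l) ℂ)

/-- The coordinates of a vector with respect to the columns of `U`. -/
def coords (U : Matrix.unitaryGroup (Fin l) ℂ) (x : Fin l → ℂ) : Fin l → ℂ :=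
  (star (U : Matrix (Fin l) (Fin l) ℂ)).mulVec x

section conjDiag

variable (U : Matrix.unitaryGroup (Fin l) ℂ) (f g : Fin l → ℂ)

lemma star_mul_self_coe : star (U : Matrix (Fin l) (Fin l) ℂ) * (U : Matrix (Fin l) (Fin l) ℂ) = 1 :=
  Matrix.mem_unitaryGroup_iff'.1 U.2

lemma mul_star_self_coe : (U : Matrix (Fin l) (Fin l) ℂ) * star (U : Matrix (Fin l) (Fin l) ℂ) = 1 :=
  Matrix.mem_unitaryGroup_iff.1 U.2

lemma conjDiag_one : conjDiag U 1 = 1 := by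
  rw [conjDiag, Matrix.diagonal_one', mul_one, mul_star_self_coe]

lemma conjDiag_mul : conjDiag U f * conjDiag U g = conjDiag U (f * g) := by
  have : Matrix.diagonal (f * g) = Matrix.diagonal f * Matrix.diagonal g := by
    rw [Matrix.diagonal_mul_diagonal]
    rfl
  simp only [conjDiag, this]
  calc _ = U * Matrix.diagonal f * (star (U : Matrix (Fin l) (Fin l) ℂ) * U)
        * Matrix.diagonal g * star (U : Matrix (Fin l) (Fin l) ℂ) := by simp only [mul_assoc]
    _ = _ := by rw [star_mul_self_coe, mul_one]; simp only [mul_assoc]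

lemma one_add_smul_conjDiag (m : ℂ) : 1 + m • conjDiag U f = conjDiag U (1 + m • f) := by
  have h : Matrix.diagonal (1 + m • f) = 1 + m • Matrix.diagonal f := by
    rw [← Matrix.diagonal_smul, ← Matrix.diagonal_one, Matrix.diagonal_add]
    rfl
  conv_rhs => rw [conjDiag, h, mul_add, add_mul, mul_one, mul_star_self_coe]
  simp [conjDiag]

lemma inv_conjDiag (hf : ∀ i, f i ≠ 0) : (conjDiag U f)⁻¹ = conjDiag U f⁻¹ := by
  refine Matrix.inv_eq_right_inv ?_
  rw [conjDiag_mul, ← conjDiag_one U]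
  congr 1
  funext i
  exact mul_inv_cancel₀ (hf i)

lemma trace_conjDiag : (conjDiag U f).trace = ∑ i, f i := by
  rw [conjDiag, Matrix.trace_mul_comm, ← mul_assoc, star_mul_self_coe, one_mul,
    Matrix.trace_diagonal]

lemma dotProduct_conjDiag_mulVec (x : Fin l → ℂ) :
    star x ⬝ᵥ (conjDiag U f).mulVec x = ∑ i, f i * ((Complex.normSq (coords U x i) : ℝ) : ℂ) := by
  have h1 : star x ⬝ᵥ (conjDiag U f).mulVec x
      = star (coords U x) ⬝ᵥ (Matrix.diagonal f).mulVec (coords U x) := by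
    rw [conjDiag, coords, ← Matrix.mulVec_mulVec, ← Matrix.mulVec_mulVec, Matrix.dotProduct_mulVec,
      Matrix.star_mulVec, Matrix.star_eq_conjTranspose, Matrix.conjTranspose_conjTranspose]
  rw [h1, dotProduct]
  refine Finset.sum_congr rfl fun i _ => ?_
  rw [Matrix.mulVec_diagonal, ← Complex.mul_conj, Pi.star_apply, Complex.star_def]
  ring

lemma sum_normSq_coords (x : Fin l → ℂ) :
    ((∑ i, Complex.normSq (coords U x i) : ℝ) : ℂ) = star x ⬝ᵥ x := by
  have h := dotProduct_conjDiag_mulVec U 1 x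
  rw [conjDiag_one, Matrix.one_mulVec] at h
  rw [h]
  simp

lemma conjDiag_mulVec (x : Fin l → ℂ) :
    (conjDiag U f).mulVec x = (U : Matrix (Fin l) (Fin l) ℂ).mulVec (f * coords U x) := by
  rw [conjDiag, coords, ← Matrix.mulVec_mulVec, ← Matrix.mulVec_mulVec]
  congr 1
  funext i
  rw [Matrix.mulVec_diagonal]
  rfl

lemma mulVec_coords (x : Fin l → ℂ) :
    (U : Matrix (Fin l) (Fin l) ℂ).mulVec (coords U x) = x := by
  rw [coords, Matrix.mulVec_mulVec, mul_star_self_coe, Matrix.one_mulVec]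

lemma coords_mulVec (x : Fin l → ℂ) :
    coords U ((U : Matrix (Fin l) (Fin l) ℂ).mulVec x) = x := by
  rw [coords, Matrix.mulVec_mulVec, star_mul_self_coe, Matrix.one_mulVec]

end conjDiag

lemma eq_conjDiag {A : Matrix (Fin l) (Fin l) ℂ} (hA : A.IsHermitian) :
    A = conjDiag hA.eigenvectorUnitary (fun i => (hA.eigenvalues i : ℂ)) := by
  conv_lhs => rw [hA.spectral_theorem, Unitary.conjStarAlgAut_apply]
  rfl

lemma isHermitian_hat {A : Matrix (Fin l) (Fin l) ℂ} (hA : A.IsHermitian) :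
    (hat A).IsHermitian := by
  have h : A.transpose.IsHermitian := hA.transpose
  rw [hat, Matrix.IsHermitian, Matrix.conjTranspose_smul, Matrix.conjTranspose_add, hA.eq, h.eq]
  simp

/-- The eigenvalues of `Â` lie between the extreme eigenvalues of `A`: the quadratic form of `Â` at
`x` is the mean of those of `A` at `x` and at its complex conjugate. -/
lemma exists_eigenvalues_hat {A : Matrix (Fin l) (Fin l) ℂ} (hA : A.IsHermitian) (j : Fin l) :
    (∃ i, (isHermitian_hat hA).eigenvalues j ≤ hA.eigenvalues i) ∧
      ∃ i, hA.eigenvalues i ≤ (isHermitian_hat hA).eigenvalues j := by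
  set hB := isHermitian_hat hA
  set t := hB.eigenvalues j
  set U := hA.eigenvectorUnitary
  set V := hB.eigenvectorUnitary
  set v : Fin l → ℂ := (V : Matrix (Fin l) (Fin l) ℂ).mulVec (Pi.single j 1) with hv
  have hvc : coords V v = Pi.single j 1 := coords_mulVec V _
  have h1 : star v ⬝ᵥ v = 1 := by
    rw [← sum_normSq_coords V, hvc]
    rw [Finset.sum_eq_single j] <;> simp +contextual
  have h1' : star (star v) ⬝ᵥ star v = 1 := by
    rw [star_star, dotProduct_comm, h1]
  have h2 : star v ⬝ᵥ (hat A).mulVec v = t := by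
    rw [eq_conjDiag hB, dotProduct_conjDiag_mulVec, hvc, Finset.sum_eq_single j] <;>
      simp +contextual [t]
  have h3 : star v ⬝ᵥ A.transpose.mulVec v = star (star v) ⬝ᵥ A.mulVec (star v) := by
    rw [Matrix.mulVec_transpose, dotProduct_comm, star_star, Matrix.dotProduct_mulVec]
  have h4 : (1 / 2 : ℂ) * (star v ⬝ᵥ A.mulVec v + star (star v) ⬝ᵥ A.mulVec (star v)) = t := by
    rw [← h2, ← h3, hat, Matrix.smul_mulVec, Matrix.add_mulVec, dotProduct_smul, dotProduct_add,
      smul_eq_mul]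
  set N : Fin l → ℝ := fun i => Complex.normSq (coords U v i)
  set N' : Fin l → ℝ := fun i => Complex.normSq (coords U (star v) i)
  have hN : ∑ i, N i = 1 := by
    have := sum_normSq_coords U v
    rw [h1] at this
    exact_mod_cast this
  have hN' : ∑ i, N' i = 1 := by
    have := sum_normSq_coords U (star v)
    rw [h1'] at this
    exact_mod_cast this
  have h5 : ∑ i, hA.eigenvalues i * (N i + N' i) = 2 * t := by
    rw [eq_conjDiag hA, dotProduct_conjDiag_mulVec, dotProduct_conjDiag_mulVec] at h4
    have h6 : (1 / 2 : ℝ) * (∑ i, hA.eigenvalues i * N i + ∑ i, hA.eigenvalues i * N' i) = t := by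
      apply Complex.ofReal_injective
      simp only [N, N']
      push_cast
      exact h4
    simp only [mul_add, Finset.sum_add_distrib]
    linarith
  have h6 : ∑ i, (hA.eigenvalues i - t) * (N i + N' i) = 0 := by
    simp only [sub_mul, Finset.sum_sub_distrib, h5, ← Finset.mul_sum, Finset.sum_add_distrib, hN,
      hN']
    ring
  have hnn : ∀ i, 0 ≤ N i + N' i := fun i => add_nonneg (Complex.normSq_nonneg _)
    (Complex.normSq_nonneg _)
  obtain ⟨i₀, hi₀⟩ : ∃ i, 0 < N i + N' i := by
    by_contra hcon
    push Not at hcon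
    have h7 : ∑ i, (N i + N' i) ≤ 0 := Finset.sum_nonpos fun i _ => hcon i
    rw [Finset.sum_add_distrib, hN, hN'] at h7
    norm_num at h7
  constructor
  · by_contra hcon
    push Not at hcon
    have := Finset.sum_neg' (s := Finset.univ)
      (f := fun i => (hA.eigenvalues i - t) * (N i + N' i))
      (fun i _ => mul_nonpos_of_nonpos_of_nonneg (by linarith [hcon i]) (hnn i))
      ⟨i₀, Finset.mem_univ _, mul_neg_of_neg_of_pos (by linarith [hcon i₀]) hi₀⟩
    exact this.ne h6
  · by_contra hcon
    push Not at hcon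
    have := Finset.sum_pos' (s := Finset.univ)
      (f := fun i => (hA.eigenvalues i - t) * (N i + N' i))
      (fun i _ => mul_nonneg (by linarith [hcon i]) (hnn i))
      ⟨i₀, Finset.mem_univ _, mul_pos (by linarith [hcon i₀]) hi₀⟩
    exact this.ne' h6

/-- The spectral data of the polynomial with the coefficients `A`, `b`, `c`. Eigenvalues of `Â`
with an eigenvector orthogonal to `b` do not contribute to `γ` and are replaced by zero. -/
def spectralData {A : Matrix (Fin l) (Fin l) ℂ} (hA : A.IsHermitian) (b : Fin l → ℝ) (c : ℝ) :
    SpectralData (Fin l) (Fin l) where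
  eig := hA.eigenvalues
  weight j := Complex.normSq (coords (isHermitian_hat hA).eigenvectorUnitary (fun i => (b i : ℂ)) j)
  hatEig j :=
    if coords (isHermitian_hat hA).eigenvectorUnitary (fun i => (b i : ℂ)) j = 0 then 0
    else (isHermitian_hat hA).eigenvalues j
  shift := c

lemma one_add_mul_ofReal_ne_zero {m : ℂ} (hm : m ∈ upper) (x : ℝ) : 1 + m * x ≠ 0 := by
  intro h
  have h1 := congrArg Complex.im h
  simp only [Complex.add_im, Complex.one_im, Complex.mul_im, Complex.ofReal_im, mul_zero,
    Complex.ofReal_re, zero_add, Complex.zero_im] at h1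
  rcases mul_eq_zero.1 h1 with h2 | h2
  · exact (mem_upper.1 hm).ne' h2
  · simp [h2] at h

lemma invMap_spectralData {A : Matrix (Fin l) (Fin l) ℂ} (hA : A.IsHermitian) (b : Fin l → ℝ)
    (c : ℝ) {m : ℂ} (hm : m ∈ upper) :
    (spectralData hA b c).invMap m = -m⁻¹ - gamma A b c m := by
  set hB := isHermitian_hat hA
  set U := hA.eigenvectorUnitary
  set V := hB.eigenvectorUnitary
  set b' : Fin l → ℂ := fun i => (b i : ℂ) with hb'
  have hstar : star b' = b' := by
    funext i
    simp [hb']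
  have hm2 : 2 * m ∈ upper := by
    have : 0 < m.im := hm
    simpa [upper] using this
  have htr : (A * (1 + m • A)⁻¹).trace
      = ∑ i, (hA.eigenvalues i : ℂ) / (1 + m * hA.eigenvalues i) := by
    have h1 : A * (1 + m • A)⁻¹ = conjDiag U ((fun i => (hA.eigenvalues i : ℂ))
        * (1 + m • fun i => (hA.eigenvalues i : ℂ))⁻¹) := by
      rw [← conjDiag_mul, ← inv_conjDiag U (1 + m • fun i => (hA.eigenvalues i : ℂ))
          fun i => one_add_mul_ofReal_ne_zero hm _,
        ← one_add_smul_conjDiag, ← eq_conjDiag hA]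
    rw [h1, trace_conjDiag]
    rfl
  have hq : b' ⬝ᵥ (((1 + (2 * m) • hat A)⁻¹) ^ 2 * (1 + m • hat A)).mulVec b'
      = ∑ j, ((spectralData hA b c).weight j : ℂ) * (1 + m * (spectralData hA b c).hatEig j)
        / (1 + 2 * m * (spectralData hA b c).hatEig j) ^ 2 := by
    have h1 : ((1 + (2 * m) • hat A)⁻¹) ^ 2 * (1 + m • hat A)
        = conjDiag V (((1 + (2 * m) • fun i => (hB.eigenvalues i : ℂ))⁻¹
          * (1 + (2 * m) • fun i => (hB.eigenvalues i : ℂ))⁻¹)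
          * (1 + m • fun i => (hB.eigenvalues i : ℂ))) := by
      rw [← conjDiag_mul, ← conjDiag_mul,
        ← inv_conjDiag V (1 + (2 * m) • fun i => (hB.eigenvalues i : ℂ))
          fun i => one_add_mul_ofReal_ne_zero hm2 _,
        ← one_add_smul_conjDiag, ← one_add_smul_conjDiag, ← eq_conjDiag hB, sq]
    rw [h1]
    nth_rewrite 1 [← hstar]
    rw [dotProduct_conjDiag_mulVec]
    refine Finset.sum_congr rfl fun j _ => ?_
    by_cases hj : coords V b' j = 0
    · simp [spectralData, hb', V] at hj ⊢
      simp [hj]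
    · have h2 : (spectralData hA b c).hatEig j = hB.eigenvalues j := if_neg hj
      rw [h2]
      change (1 + 2 * m * (hB.eigenvalues j : ℂ))⁻¹ * (1 + 2 * m * (hB.eigenvalues j : ℂ))⁻¹
          * (1 + m * (hB.eigenvalues j : ℂ)) * ((Complex.normSq (coords V b' j) : ℝ) : ℂ)
        = ((Complex.normSq (coords V b' j) : ℝ) : ℂ) * (1 + m * (hB.eigenvalues j : ℂ))
          / (1 + 2 * m * (hB.eigenvalues j : ℂ)) ^ 2
      rw [div_eq_mul_inv, ← inv_pow]
      ring
  rw [gamma, htr, hq, SpectralData.invMap]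
  simp only [spectralData]
  ring

lemma isSolution_spectralData {A : Matrix (Fin l) (Fin l) ℂ} (hA : A.IsHermitian) {b : Fin l → ℝ}
    {c : ℝ} {m : ℂ → ℂ} (h : SolvesScalarEquation A b c m) :
    (spectralData hA b c).IsSolution m where
  mapsTo := h.mapsTo
  analytic := h.analytic
  tendsto := h.tendsto
  equation z hz := by
    rw [invMap_spectralData hA b c (h.mapsTo hz), h.equation z hz]
    ring

/-! ### Shifted reducible polynomials -/

/-- A polynomial is shifted reducible if `A` has rank one and `b` is of the corresponding form. -/
lemma isShiftedReducible_of_coeff {A : Matrix (Fin l) (Fin l) ℂ} {b : Fin l → ℝ} {c α ξ : ℝ}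
    (v : EuclideanSpace ℂ (Fin l)) (hα : α ≠ 0) (hξ : 0 ≤ ξ) (hv : ‖v‖ = 1)
    (hA : ∀ i j, A i j = α * ((starRingEnd ℂ) (v i) * v j))
    (hb : ∀ i, (b i : ℂ) = -(α * ξ) * ((starRingEnd ℂ) (v i) + v i)) :
    IsShiftedReducible (poly A b c) := by
  refine ⟨α, α * ξ ^ 2 - c, ξ, v, hα, hξ, hv, ?_⟩
  set x : Fin l → FreeAlgebra ℂ (Fin l) := FreeAlgebra.ι ℂ
  set S := ∑ i, (starRingEnd ℂ) (v i) • x i with hS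
  set T := ∑ i, v i • x i with hT
  have h1 : ∑ i, ∑ j, A i j • (x i * x j) = (α : ℂ) • (S * T) := by
    rw [hS, hT, Finset.sum_mul_sum, Finset.smul_sum]
    refine Finset.sum_congr rfl fun i _ => ?_
    rw [Finset.smul_sum]
    refine Finset.sum_congr rfl fun j _ => ?_
    rw [hA, smul_mul_smul_comm, smul_smul]
  have h2 : ∑ i, (b i : ℂ) • x i = (-(α * ξ) : ℂ) • (S + T) := by
    rw [hS, hT, ← Finset.sum_add_distrib, Finset.smul_sum]
    refine Finset.sum_congr rfl fun i _ => ?_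
    rw [hb, ← add_smul, smul_smul]
  rw [poly, h1, h2]
  simp only [Algebra.algebraMap_eq_smul_one, sub_mul, mul_sub, smul_mul_assoc, mul_smul_comm,
    one_mul, mul_one]
  push_cast
  module

/-- If `A` has rank one and `b` lies in the range of `Â`, then the polynomial is shifted
reducible. -/
lemma isShiftedReducible_of_rank_one {A : Matrix (Fin l) (Fin l) ℂ} (hA : A.IsHermitian)
    (b : Fin l → ℝ) (c : ℝ) {i₀ : Fin l} (h0 : hA.eigenvalues i₀ ≠ 0)
    (hi : ∀ i, i ≠ i₀ → hA.eigenvalues i = 0) {x : Fin l → ℂ}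
    (hx : (hat A).mulVec x = fun i => (b i : ℂ)) : IsShiftedReducible (poly A b c) := by
  set α := hA.eigenvalues i₀
  set U := hA.eigenvectorUnitary
  set u : Fin l → ℂ := fun i => (U : Matrix (Fin l) (Fin l) ℂ) i i₀ with hu
  have hAu : ∀ i j, A i j = α * (u i * (starRingEnd ℂ) (u j)) := by
    intro i j
    conv_lhs => rw [eq_conjDiag hA]
    rw [conjDiag, Matrix.mul_apply, Finset.sum_eq_single i₀]
    · rw [Matrix.mul_diagonal, Matrix.star_apply, Complex.star_def]
      ring
    · intro k _ hk
      rw [Matrix.mul_diagonal, hi k hk]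
      simp
    · simp
  have hunorm : ∑ i, ‖u i‖ ^ 2 = 1 := by
    have h1 := congrFun (congrFun (star_mul_self_coe U) i₀) i₀
    rw [Matrix.mul_apply, Matrix.one_apply_eq] at h1
    have h2 : ∑ i, ((‖u i‖ ^ 2 : ℝ) : ℂ) = 1 := by
      rw [← h1]
      refine Finset.sum_congr rfl fun i _ => ?_
      rw [Matrix.star_apply, Complex.star_def, Complex.conj_mul']
      push_cast
      rfl
    exact_mod_cast h2
  -- `b = (α / 2) Re (ζ u)`
  set ζ : ℂ := ∑ k, (starRingEnd ℂ) (u k) * x k + (starRingEnd ℂ) (∑ k, u k * x k) with hζ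
  have hb : ∀ i, b i = α / 2 * (ζ * u i).re := by
    intro i
    have h1 : (b i : ℂ) = (α / 2 : ℝ) * (u i * ∑ k, (starRingEnd ℂ) (u k) * x k
        + (starRingEnd ℂ) (u i) * ∑ k, u k * x k) := by
      rw [← congrFun hx i, Matrix.mulVec, dotProduct, Finset.mul_sum, Finset.mul_sum,
        ← Finset.sum_add_distrib, Finset.mul_sum]
      refine Finset.sum_congr rfl fun k _ => ?_
      rw [hat, Matrix.smul_apply, Matrix.add_apply, Matrix.transpose_apply, hAu, hAu, smul_eq_mul]
      push_cast
      ring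
    have h2 := congrArg Complex.re h1
    rw [Complex.ofReal_re, Complex.re_ofReal_mul] at h2
    rw [h2, hζ, add_mul]
    congr 1
    simp only [Complex.add_re, Complex.mul_re, Complex.conj_re, Complex.conj_im]
    ring
  obtain ⟨ω, hω, hωζ⟩ := RCLike.exists_norm_mul_eq_self (K := ℂ) ζ
  refine isShiftedReducible_of_coeff (α := α) (ξ := ‖ζ‖ / 4)
    (WithLp.toLp 2 fun i => -(starRingEnd ℂ) (ω * u i)) h0 (by positivity) ?_ ?_ ?_
  · rw [EuclideanSpace.norm_eq]
    simp [hω, hunorm]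
  · intro i j
    have h1 : ω * (starRingEnd ℂ) ω = 1 := by
      rw [Complex.mul_conj', hω]
      simp
    rw [hAu]
    simp only [map_neg, map_mul, Complex.conj_conj]
    linear_combination -(α * (u i * (starRingEnd ℂ) (u j))) * h1
  · intro i
    have h1 : (starRingEnd ℂ) (-(starRingEnd ℂ) (ω * u i)) + -(starRingEnd ℂ) (ω * u i)
        = -((2 * (ω * u i).re : ℝ) : ℂ) := by
      rw [map_neg, Complex.conj_conj, ← neg_add, Complex.add_conj]
    have h2 : (ζ * u i).re = ‖ζ‖ * (ω * u i).re := by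
      rw [← Complex.re_ofReal_mul]
      congr 1
      conv_lhs => rw [← hωζ]
      simp only [Complex.coe_algebraMap]
      ring
    rw [hb i, h2]
    simp only at h1 ⊢
    rw [h1]
    push_cast
    ring

/-- The spectral data of a polynomial that is not shifted reducible. -/
lemma nonReducible_spectralData {A : Matrix (Fin l) (Fin l) ℂ} (hA : A.IsHermitian) (hA0 : A ≠ 0)
    (b : Fin l → ℝ) (c : ℝ) (hq : ¬ IsShiftedReducible (poly A b c)) :
    (spectralData hA b c).NonReducible := by
  set hB := isHermitian_hat hA
  set V := hB.eigenvectorUnitary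
  set b' : Fin l → ℂ := fun i => (b i : ℂ) with hb'
  have hif : ∀ j, (spectralData hA b c).hatEig j ≠ 0 →
      coords V b' j ≠ 0 ∧ (spectralData hA b c).hatEig j = hB.eigenvalues j := by
    intro j hj
    by_cases h : coords V b' j = 0
    · exact absurd (if_pos h) hj
    · exact ⟨h, if_neg h⟩
  obtain ⟨i₀, hi₀⟩ : ∃ i, hA.eigenvalues i ≠ 0 := by
    by_contra hcon
    push Not at hcon
    exact hA0 (hA.eigenvalues_eq_zero_iff.1 (funext hcon))
  refine ⟨fun j => Complex.normSq_nonneg _, fun j hj => ?_, fun j hj => ?_, fun j hj => ?_,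
    ⟨i₀, hi₀⟩, ?_⟩
  · rw [(hif j hj.ne').2]
    exact (exists_eigenvalues_hat hA j).1
  · rw [(hif j hj.ne).2]
    exact (exists_eigenvalues_hat hA j).2
  · exact fun h => (hif j hj).1 (Complex.normSq_eq_zero.1 h)
  · by_contra hcon
    push Not at hcon
    obtain ⟨h1, h2⟩ := hcon
    refine hq (isShiftedReducible_of_rank_one hA b c hi₀ (fun i hi => ?_)
      (x := (conjDiag V fun j => (hB.eigenvalues j : ℂ)⁻¹).mulVec b') ?_)
    · by_contra hne
      exact hi₀ (h1 i i₀ hi hne)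
    · refine (congrArg (fun B : Matrix (Fin l) (Fin l) ℂ => B.mulVec _) (eq_conjDiag hB)).trans ?_
      rw [Matrix.mulVec_mulVec, conjDiag_mul, conjDiag_mulVec]
      conv_rhs => rw [← hb', ← mulVec_coords V b']
      congr 1
      funext j
      by_cases hj : coords V b' j = 0
      · simp [show coords hB.eigenvectorUnitary b' j = 0 from hj, hj]
      · have h3 : (spectralData hA b c).hatEig j = hB.eigenvalues j := if_neg hj
        have h4 := h2 j fun h => hj (Complex.normSq_eq_zero.1 h)
        rw [h3] at h4
        have h5 : (hB.eigenvalues j : ℂ) ≠ 0 := by exact_mod_cast h4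
        simp [h5, V]

end QuadPoly

end

theorem proposition2p4 {l : ℕ} (A : Matrix (Fin l) (Fin l) ℂ) (b : Fin l → ℝ) (c : ℝ)
    (hA : A.IsHermitian) (hA0 : A ≠ 0)
    (hq : ¬ QuadPoly.IsShiftedReducible (QuadPoly.poly A b c))
    (ρ : MeasureTheory.Measure ℝ) (hρ : QuadPoly.IsSelfConsistentDensityOfStates A b c ρ) :
    ∃ τm τp : ℝ, IsLeast ρ.support τm ∧ IsGreatest ρ.support τp ∧
      QuadPoly.HasRegularEdge ρ τm ∧ QuadPoly.HasRegularEdge ρ τp := by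
  obtain ⟨hprob, hsol⟩ := hρ
  have hd := QuadPoly.nonReducible_spectralData hA hA0 b c hq
  have hs := QuadPoly.isSolution_spectralData hA hsol
  have hprob' : MeasureTheory.IsProbabilityMeasure (ρ.map Neg.neg) :=
    MeasureTheory.Measure.isProbabilityMeasure_map measurable_neg.aemeasurable
  obtain ⟨τm, hm, hedge⟩ := hs.exists_isLeast hd
  obtain ⟨σ, hσ, hedge'⟩ := hs.reflect.exists_isLeast hd.neg
  refine ⟨τm, -σ, hm, ⟨QuadPoly.mem_support_map_neg.1 hσ.1, fun x hx => ?_⟩, hedge,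
    hedge'.reflect⟩
  have h := hσ.2 (QuadPoly.mem_support_map_neg.2 (by rwa [neg_neg]) : -x ∈ _)
  linarith
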